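/- Let $k,m\ge 0$ be integers. Consider complex polynomials in $k+1$ vector variables $x=u_0,u_1,\dots,u_k\in\mathbb R^m$. Write $\langle u_i,\partial_j\rangle=\sum_a u_{i,a}\partial_{u_{j,a}}$ and $\langle\partial_i,\partial_j\rangle=\sum_a\partial_{u_{i,a}}\partial_{u_{j,a}}$, where an index $x$ means the index $0$. The Lie algebra $\mathfrak{gl}(k+1)$ acts on these polynomials by $E_{ij}\mapsto\langle u_i,\partial_j\rangle$ for $i\ne j$ and $E_{ii}\mapsto\langle u_i,\partial_i\rangle+\frac m2$ ($0\le i,j\le k$). For a tuple of degrees, let $\mathcal H_\mu$ denote the space of simplicial harmonics: polynomials that are homogeneous of degree $\mu_i$ in $u_i$ for each $i$ and are annihilated by all $\langle\partial_i,\partial_j\rangle$ and by all $\langle u_i,\partial_j\rangle$ with $i<j$. (The same definition is used in the $k$ variables $u_1,\dots,u_k$.) Let $\mathcal V(\mu)^*=\mathcal U(\mathfrak{gl}(k+1))\,\mathcal H_\mu$ be the $\mathfrak{gl}(k+1)$-module generated by $\mathcal H_\mu=\mathcal H_{\mu_0,\dots,\mu_k}$. For $\lambda_0\in\mathbb N$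 and $\lambda\in\mathbb N^k$, let $\ker^A_{\lambda_0}\mathcal D_\lambda$ be the space of type A solutions of the higher spin Laplace operator $\mathcal D_\lambda$: polynomials $P(x;u_1,\dots,u_k)$ that are homogeneous of degree $\lambda_0$ in $x$, take values in $\mathcal H_\lambda$ (that is, $P(x;\cdot)\in\mathcal H_\lambda$ for every fixed $x\in\mathbb R^m$), and satisfy $\Delta_xP=0$ and $\langle\partial_i,\partial_x\rangle P=0$ for $1\le i\le k$. There are elements $\rho_{d_1,\dots,d_k}\in\mathcal U(\mathfrak{gl}(k+1))$, $d\in\mathbb N^k$, with $\rho_{d_1,\dots,d_k}$ homogeneous of degree $d_j$ in $u_j$, i.e. $[E_{jj},\rho_{d_1,\dots,d_k}]=d_j\,\rho_{d_1,\dots,d_k}$ for $1\le j\le k$, such that the following holds for every $\mu_0\ge\mu_1\ge\dots\ge\mu_k\ge0$. Say that $d$ satisfies the betweenness conditions if $$0\le d_p\le\mu_{p-1}-\mu_p\quad(1\le p\le k),$$ equivalently $\mu_0\ge\mu_1+d_1\ge\mu_1\ge\dots\ge\mu_{k-1}\ge\mu_k+d_k\ge\mu_k$. 1. If $d$ satisfies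 the betweenness conditions, then $\rho_{d_1,\dots,d_k}$ is an embedding factor: it is injective on $\mathcal H_\mu$, and its action on polynomials commutes with the natural action of $O(m)$. Moreover, for $\lambda_0=\mu_0-\sum_jd_j$ and $\lambda=(\mu_1+d_1,\dots,\mu_k+d_k)$, $$\mathcal V(\mu)^*\cap\ker^A_{\lambda_0}\mathcal D_\lambda=\rho_{d_1,\dots,d_k}\mathcal H_\mu .$$ 2. If $\mathcal V(\mu)^*\cap\ker^A_{\lambda_0}\mathcal D_\lambda\ne0$ for some $\lambda_0\in\mathbb N$ and $\lambda\in\mathbb N^k$, then $\lambda_0=\mu_0-\sum_jd_j$ and $\lambda=(\mu_1+d_1,\dots,\mu_k+d_k)$ for some $d$ satisfying the betweenness conditions. 3. Altogether, $$\mathcal V(\mu)^*\cap\sum_{\lambda_0,\lambda}\ker^A_{\lambda_0}\mathcal D_\lambda=\bigoplus_{d}\rho_{d_1,\dots,d_k}\mathcal H_\mu ,$$ where the direct sum runs over all $d\in\mathbb N^k$ satisfying the betweenness conditions. -/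

import Mathlib

/-! Polynomials in several vector variables, the Howe dual `gl` action, simplicial harmonics,
and type A solutions of the higher spin Laplace operators. -/

namespace HigherSpin

open MvPolynomial

attribute [local instance] LieRing.ofAssociativeRing

/-- Complex valued polynomials in `n` vector variables of `ℝ^m`; `X (i, a)` is the `a`-th
coordinate of the `i`-th vector variable. -/
abbrev VPoly (n m : ℕ) : Type := MvPolynomial (Fin n × Fin m) ℂ

section operators

variable {n m : ℕ}

/-- `⟨∂_i, ∂_j⟩ = ∑ a, ∂/∂u_{i,a} ∂/∂u_{j,a}`; for `i = j` this is the Laplacian in `u_i`. -/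
noncomputable def dotDD (i j : Fin n) : Module.End ℂ (VPoly n m) :=
  ∑ a : Fin m, (pderiv (i, a)).toLinearMap ∘ₗ (pderiv (j, a)).toLinearMap

/-- `⟨u_i, ∂_j⟩ = ∑ a, u_{i,a} ∂/∂u_{j,a}`; for `i = j` this is the Euler operator in `u_i`. -/
noncomputable def dotUD (i j : Fin n) : Module.End ℂ (VPoly n m) :=
  ∑ a : Fin m, LinearMap.mulLeft ℂ (X (i, a) : VPoly n m) ∘ₗ (pderiv (j, a)).toLinearMap

/-- The operator representing the matrix unit `E_{ij}`: the skew Euler operator `⟨u_i, ∂_j⟩`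
for `i ≠ j`, and the Euler operator in `u_i` plus `m / 2` for `i = j`. -/
noncomputable def opE (i j : Fin n) : Module.End ℂ (VPoly n m) :=
  dotUD i j + (if i = j then (m : ℂ) / 2 else 0) • LinearMap.id

/-- The polynomials that are homogeneous of degree `μ i` in the `i`-th vector variable,
for every `i`. -/
noncomputable def multiHomogeneous (n m : ℕ) (μ : Fin n → ℕ) : Submodule ℂ (VPoly n m) :=
  weightedHomogeneousSubmodule ℂ (fun p : Fin n × Fin m => (Pi.single p.1 1 : Fin n → ℕ)) μ

/-- The space `H_μ` of simplicial harmonics of degree `μ i` in the `i`-th vector variable. -/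
noncomputable def simplicialHarmonics (n m : ℕ) (μ : Fin n → ℕ) : Submodule ℂ (VPoly n m) :=
  multiHomogeneous n m μ ⊓
    (⨅ (i : Fin n) (j : Fin n), LinearMap.ker (dotDD (m := m) i j)) ⊓
    (⨅ (i : Fin n) (j : Fin n) (_ : i < j), LinearMap.ker (dotUD (m := m) i j))

/-- The natural action of a matrix `g` on polynomials, by `gᵀ` on every vector variable; for
orthogonal `g` this is `P (u_1, …, u_n) ↦ P (g⁻¹ u_1, …, g⁻¹ u_n)`. -/
noncomputable def rotate (n : ℕ) {m : ℕ} (g : Matrix (Fin m) (Fin m) ℝ) :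
    VPoly n m →ₐ[ℂ] VPoly n m :=
  aeval (fun p : Fin n × Fin m =>
    ∑ b : Fin m, (C ((g b p.2 : ℝ) : ℂ) * X (p.1, b) : VPoly n m))

theorem dotUD_apply (i j : Fin n) (P : VPoly n m) :
    dotUD i j P = ∑ a : Fin m, X (i, a) * pderiv (j, a) P := by
  simp [dotUD]

theorem pderiv_comm_apply (p q : Fin n × Fin m) (P : VPoly n m) :
    pderiv p (pderiv q P) = pderiv q (pderiv p P) := by
  have h : ⁅(pderiv p : Derivation ℂ (VPoly n m) (VPoly n m)),
      (pderiv q : Derivation ℂ (VPoly n m) (VPoly n m))⁆ = 0 := by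
    refine derivation_ext fun i => ?_
    classical
    simp [Derivation.commutator_apply, pderiv_X, Pi.single_apply, apply_ite]
  have h2 := congrArg (fun D : Derivation ℂ (VPoly n m) (VPoly n m) => D P) h
  simpa [Derivation.commutator_apply, sub_eq_zero] using h2

theorem dotUD_comm (i j k l : Fin n) (P : VPoly n m) :
    dotUD i j (dotUD k l P) - dotUD k l (dotUD i j P)
      = (if j = k then dotUD i l P else 0) - (if l = i then dotUD k j P else 0) := by
  have key : ∀ (i j k l : Fin n), dotUD i j (dotUD k l P)
      = (if j = k then dotUD i l P else 0)
        + ∑ a : Fin m, ∑ b : Fin m,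
            X (i, a) * (X (k, b) * pderiv (j, a) (pderiv (l, b) P)) := by
    intro i j k l
    rw [dotUD_apply i j, dotUD_apply k l]
    simp only [map_sum, Derivation.leibniz, smul_eq_mul, pderiv_X, Finset.mul_sum, mul_add,
      Finset.sum_add_distrib]
    rw [add_comm]
    congr 1
    by_cases h : j = k
    · subst h
      rw [if_pos rfl, dotUD_apply]
      refine Finset.sum_congr rfl fun a _ => ?_
      rw [Finset.sum_eq_single a]
      · simp
      · intro b _ hb
        rw [Pi.single_eq_of_ne (by simpa using hb)]
        simp
      · simp
    · rw [if_neg h]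
      refine Finset.sum_eq_zero fun a _ => Finset.sum_eq_zero fun b _ => ?_
      rw [Pi.single_eq_of_ne (by simpa using fun h' => absurd h'.symm h)]
      simp
  rw [key i j k l, key k l i j]
  have : ∑ a : Fin m, ∑ b : Fin m, X (i, a) * (X (k, b) * pderiv (j, a) (pderiv (l, b) P))
      = ∑ a : Fin m, ∑ b : Fin m, X (k, a) * (X (i, b) * pderiv (l, a) (pderiv (j, b) P)) := by
    rw [Finset.sum_comm]
    refine Finset.sum_congr rfl fun a _ => Finset.sum_congr rfl fun b _ => ?_
    rw [pderiv_comm_apply]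
    ring
  rw [this]
  ring

theorem opE_comm (i j k l : Fin n) :
    opE (m := m) i j * opE k l - opE k l * opE i j
      = (if j = k then opE i l else 0) - (if l = i then opE k j else 0) := by
  have h : opE (m := m) i j * opE k l - opE k l * opE i j
      = (if j = k then dotUD i l else 0) - (if l = i then dotUD k j else 0) := by
    refine LinearMap.ext fun P => ?_
    have := dotUD_comm (m := m) i j k l P
    have e : ∀ (c : Prop) [Decidable c] (f : Module.End ℂ (VPoly n m)),
        (if c then f else 0) P = if c then f P else 0 := by
      intro c _ f; split_ifs <;> rfl
    rw [LinearMap.sub_apply, LinearMap.sub_apply, e, e, ← this]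
    simp only [opE, Module.End.mul_apply, LinearMap.add_apply, LinearMap.smul_apply,
      LinearMap.id_apply, map_add, map_smul]
    module
  rw [h]
  by_cases h1 : j = k <;> by_cases h2 : l = i
  · subst h1; subst h2; simp [opE]
  · subst h1; simp [opE, h2, Ne.symm h2]
  · subst h2; simp [opE, h1, Ne.symm h1]
  · simp [h1, h2]

/-- The action of a matrix of `gl(n)` on polynomials, with `E_{ij}` acting as `opE i j`. -/
noncomputable def glLinear (n m : ℕ) :
    Matrix (Fin n) (Fin n) ℂ →ₗ[ℂ] Module.End ℂ (VPoly n m) where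
  toFun A := ∑ i : Fin n, ∑ j : Fin n, A i j • opE i j
  map_add' A B := by simp [add_smul, Finset.sum_add_distrib]
  map_smul' c A := by simp [Finset.smul_sum, mul_smul]

theorem glLinear_single (i j : Fin n) :
    glLinear n m (Matrix.single i j 1) = opE i j := by
  simp only [glLinear, LinearMap.coe_mk, AddHom.coe_mk]
  rw [Finset.sum_eq_single i, Finset.sum_eq_single j]
  · simp
  · intro b _ hb; simp [Ne.symm hb]
  · simp
  · intro b _ hb; simp [Ne.symm hb]
  · simp

theorem glLinear_lie (A B : Matrix (Fin n) (Fin n) ℂ) :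
    glLinear n m ⁅A, B⁆ = ⁅glLinear n m A, glLinear n m B⁆ := by
  simp only [Ring.lie_def]
  induction A using Matrix.induction_on' with
  | h_zero => simp
  | h_add p q hp hq => rw [add_mul, mul_add, add_sub_add_comm, map_add, hp, hq, map_add]; noncomm_ring
  | h_std_basis i j x =>
    induction B using Matrix.induction_on' with
    | h_zero => simp
    | h_add p q hp hq =>
      rw [add_mul, mul_add, add_sub_add_comm, map_add, hp, hq, map_add]; noncomm_ring
    | h_std_basis k l y =>
      have hs : ∀ (i j : Fin n) (x : ℂ), Matrix.single i j x = x • Matrix.single i j (1 : ℂ) := by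
        intro i j x; simp
      rw [hs i j x, hs k l y]
      have e1 : (Matrix.single i j (1 : ℂ) * Matrix.single k l 1 : Matrix (Fin n) (Fin n) ℂ)
          = if j = k then Matrix.single i l 1 else 0 := by
        by_cases h : j = k
        · subst h; simp
        · simp [h]
      have e2 : (Matrix.single k l (1 : ℂ) * Matrix.single i j 1 : Matrix (Fin n) (Fin n) ℂ)
          = if l = i then Matrix.single k j 1 else 0 := by
        by_cases h : l = i
        · subst h; simp
        · simp [h]
      have e3 : glLinear n m (Matrix.single i j (1 : ℂ) * Matrix.single k l 1
          - Matrix.single k l (1 : ℂ) * Matrix.single i j 1)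
          = opE i j * opE k l - opE k l * opE i j := by
        rw [e1, e2, opE_comm, map_sub, apply_ite (glLinear n m), apply_ite (glLinear n m), map_zero,
          glLinear_single, glLinear_single]
      rw [smul_mul_smul_comm, smul_mul_smul_comm, mul_comm y x, ← smul_sub, map_smul, e3, map_smul,
        map_smul, glLinear_single, glLinear_single, smul_mul_smul_comm, smul_mul_smul_comm,
        mul_comm y x]
      exact smul_sub _ _ _

end operators

/-- The universal enveloping algebra of `gl(n)` over `ℂ`. -/
abbrev UGl (n : ℕ) : Type := UniversalEnvelopingAlgebra ℂ (Matrix (Fin n) (Fin n) ℂ)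

/-- The matrix unit `E_{ij}` as an element of `U(gl(n))`. -/
noncomputable def unitE {n : ℕ} (i j : Fin n) : UGl n :=
  UniversalEnvelopingAlgebra.ι ℂ (Matrix.single i j (1 : ℂ))

/-- The representation of `gl(n)` on polynomials in `n` vector variables with
`E_{ij} ↦ ⟨u_i, ∂_j⟩` for `i ≠ j` and `E_{ii} ↦ ⟨u_i, ∂_i⟩ + m / 2`. -/
noncomputable def glRep (n m : ℕ) :
    Matrix (Fin n) (Fin n) ℂ →ₗ⁅ℂ⁆ Module.End ℂ (VPoly n m) :=
  { glLinear n m with map_lie' := fun {A B} => glLinear_lie A B }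

/-- The induced action of `U(gl(n))` on polynomials in `n` vector variables. -/
noncomputable def act (n m : ℕ) : UGl n →ₐ[ℂ] Module.End ℂ (VPoly n m) :=
  UniversalEnvelopingAlgebra.lift ℂ (glRep n m)

theorem act_unitE (n m : ℕ) (i j : Fin n) : act n m (unitE i j) = opE (m := m) i j := by
  rw [act, unitE, UniversalEnvelopingAlgebra.lift_ι_apply]
  exact glLinear_single i j

/-- The `gl(n)`-module generated by the space `H_μ` of simplicial harmonics. -/
noncomputable def generatedModule (n m : ℕ) (μ : Fin n → ℕ) : Submodule ℂ (VPoly n m) :=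
  Submodule.span ℂ {P | ∃ a : UGl n, ∃ H ∈ simplicialHarmonics n m μ, P = act n m a H}

/-- `ρ ∈ U(gl(k+1))` is homogeneous of degree `d p` in the vector variable `u_p`, where
`p = 1, …, k` (the vector variables are `u_0 = x, u_1, …, u_k`): `[E_{pp}, ρ] = d_p ρ`. -/
def IsHomogeneousFactor {k : ℕ} (d : Fin k → ℕ) (ρ : UGl (k + 1)) : Prop :=
  ∀ p : Fin k, unitE p.succ p.succ * ρ - ρ * unitE p.succ p.succ = (d p : ℂ) • ρ

/-- The polynomial `P (x, ·)` in `u_1, …, u_k` obtained from a polynomial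
`P (u_0, u_1, …, u_k)` by fixing the value `x` of the vector variable `u_0`. -/
noncomputable def fixFirst {k m : ℕ} (x : Fin m → ℝ) : VPoly (k + 1) m →ₐ[ℂ] VPoly k m :=
  aeval (fun p : Fin (k + 1) × Fin m =>
    (Fin.cases (C ((x p.2 : ℝ) : ℂ)) (fun i : Fin k => X (i, p.2)) p.1 : VPoly k m))

/-- The space of type A solutions of the higher spin Laplace operator `D_l` that are homogeneous
of degree `l₀` in `x`: the `H_l`-valued polynomials of degree `l₀` in `x = u_0` that lie in
the kernel of `Δ_x` and of `⟨∂_i, ∂_x⟩` for `1 ≤ i ≤ k`. -/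
noncomputable def typeA (k m : ℕ) (l₀ : ℕ) (l : Fin k → ℕ) : Submodule ℂ (VPoly (k + 1) m) :=
  weightedHomogeneousSubmodule ℂ
      (fun p : Fin (k + 1) × Fin m => if p.1 = 0 then (1 : ℕ) else 0) l₀ ⊓
    (⨅ x : Fin m → ℝ, (simplicialHarmonics k m l).comap (fixFirst x).toLinearMap) ⊓
    LinearMap.ker (dotDD (m := m) (0 : Fin (k + 1)) 0) ⊓
    (⨅ i : Fin k, LinearMap.ker (dotDD (m := m) i.succ (0 : Fin (k + 1))))

/-- The space of all (polynomial) type A solutions in `k` dummy vector variables. -/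
noncomputable def typeATotal (k m : ℕ) : Submodule ℂ (VPoly (k + 1) m) :=
  ⨆ (l₀ : ℕ) (l : Fin k → ℕ), typeA k m l₀ l

/-- The betweenness conditions `0 ≤ d_p ≤ μ_{p-1} - μ_p` for `1 ≤ p ≤ k`. -/
def Betweenness {k : ℕ} (μ : Fin (k + 1) → ℕ) (d : Fin k → ℕ) : Prop :=
  ∀ p : Fin k, μ p.succ + d p ≤ μ p.castSucc

end HigherSpin

/-!
The Fischer inner product on polynomials makes `⟨u_i, ∂_j⟩` and `⟨u_j, ∂_i⟩` adjoint to each other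
(`fischer_dotUD`), and the elements of `H_μ` are highest weight vectors of `gl(k+1)` of weight `μ`
(up to the shift by `m / 2`). A polynomial is a type A solution exactly if it is homogeneous,
harmonic and a highest weight vector of the subalgebra `gl(k)` on the indices `1, …, k`
(`mem_typeA_iff`). As harmonicity is preserved by `gl(k+1)`, the theorem is the branching rule
from `gl(k+1)` to `gl(k)` on the module `M` generated by `H_μ`.

Let `n⁻` be the strictly lower triangular part of `gl(k)`.

* Upper bound. Reordering lowering operators gives `M = n⁻ M + ∑_d E_{k0}^{d_k} ⋯ E_{10}^{d_1} H_μ`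
  (`loweringSpan_le_sup_lowerPow`). The summands that violate betweenness lie in `n⁻ M`
  (`lowerPow_mem_lowerPart`), because `E_{p,p-1}` is nilpotent on `H_μ` of order
  `μ_{p-1} - μ_p + 1`, and `E_{p0} = [E_{p,p-1}, E_{p-1,0}]` for `p ≥ 2`. Highest weight vectors of
  `gl(k)` are orthogonal to `n⁻ M`, so they are determined by their classes modulo `n⁻ M`.

* Embedding factors. For `1 ≤ p ≤ k` there is an explicit lowering operator `lowerOp p` in
  `U(gl(k+1))`, with coefficients polynomial in the `E_{jj}`, that preserves highest weight vectors
  of `gl(k)` (`act_lowerOp_mem_subHighest`) and is congruent to a multiple of `E_{p0}` modulo `n⁻`;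
  the multiple is nonzero on dominant weights. The embedding factor is the ordered product of
  `lowerOp p ^ d_p`. Under betweenness it agrees on `H_μ` with a nonzero multiple of
  `E_{k0}^{d_k} ⋯ E_{10}^{d_1}` modulo `n⁻ M` (`act_embeddingFactor`). With the upper bound, all
  highest weight vectors of `gl(k)` in `M` are sums of images of embedding factors
  (`generatedModule_inf_subHighest_le`), and these images have different degrees.

* Injectivity. It remains to see that `E_{k0}^{d_k} ⋯ E_{10}^{d_1} h` is not in the image of `n⁻`
  on the module generated by a nonzero `h ∈ H_μ`. This depends on the weight only: for highest
  weight vectors `h`, `h'` of the same weight, the module generated by `(h, h')` is a graph, by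
  positivity of the Fischer inner product (`eq_zero_of_mem_loweringSpan_prod`). For `h'` one takes
  a product of powers of leading minors of a square matrix of variables. There the vector is not
  orthogonal to a product of minors that is visibly a highest weight vector of `gl(k)`
  (`lowerPow_modelVector_notMem`).
-/

namespace HigherSpin

open MvPolynomial

attribute [local instance] LieRing.ofAssociativeRing

/-! ### Highest weight vectors of `gl(k+1)` and lowering words -/

section generic

variable {k n : ℕ} {W : Type*} [AddCommGroup W] [Module ℂ W]

/-- The operators `e i j` satisfy the commutation relations of the matrix units `E_{ij}`
of `gl(n)`. -/
def GlRelations (e : Fin n → Fin n → Module.End ℂ W) : Prop :=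
  ∀ (i j l r : Fin n) (v : W), e i j (e l r v) =
    e l r (e i j v) + ((if j = l then e i r v else 0) - (if r = i then e l j v else 0))

/-- `v` is a highest weight vector of weight `ν` for operators `e i j` that satisfy the
relations of `gl(n)`; the vector `0` is allowed. -/
structure IsHighestWeight (e : Fin n → Fin n → Module.End ℂ W) (ν : Fin n → ℂ) (v : W) :
    Prop where
  raise : ∀ i j, i < j → e i j v = 0
  weight : ∀ i, e i i v = ν i • v

/-- Vectors obtained from vectors of `H` by the commuting operators `e q 0`, `1 ≤ q`. -/
inductive AbelianWord (e : Fin (k + 1) → Fin (k + 1) → Module.End ℂ W) (H : Submodule ℂ W) :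
    W → Prop
  | base (h : W) (hh : h ∈ H) : AbelianWord e H h
  | step (q : Fin k) (w : W) (hw : AbelianWord e H w) : AbelianWord e H (e q.succ 0 w)

/-- Vectors obtained from vectors of `H` by applying first operators `e q 0` and then operators
`e i j` with `1 ≤ j < i`. -/
inductive LoweringWord (e : Fin (k + 1) → Fin (k + 1) → Module.End ℂ W) (H : Submodule ℂ W) :
    W → Prop
  | ofAbelian (w : W) (hw : AbelianWord e H w) : LoweringWord e H w
  | step (i j : Fin k) (hij : j < i) (w : W) (hw : LoweringWord e H w) :
      LoweringWord e H (e i.succ j.succ w)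

/-- The span of the lowering words. If `H` consists of highest weight vectors, it is the
`gl(k+1)`-module generated by `H`. -/
def loweringSpan (e : Fin (k + 1) → Fin (k + 1) → Module.End ℂ W) (H : Submodule ℂ W) :
    Submodule ℂ W :=
  Submodule.span ℂ {w | LoweringWord e H w}

variable {e : Fin (k + 1) → Fin (k + 1) → Module.End ℂ W} {H : Submodule ℂ W}
  {ν : Fin (k + 1) → ℂ}

theorem mem_loweringSpan_of_mem {h : W} (hh : h ∈ H) : h ∈ loweringSpan e H :=
  Submodule.subset_span (.ofAbelian _ (.base _ hh))

theorem apply_mem_of_forall_generator {s : Set W} {N : Submodule ℂ W} (f : Module.End ℂ W)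
    (hf : ∀ w ∈ s, f w ∈ N) {w : W} (hw : w ∈ Submodule.span ℂ s) : f w ∈ N := by
  have : Submodule.span ℂ s ≤ N.comap f := Submodule.span_le.2 hf
  exact this hw

theorem lower_mem_loweringSpan {i j : Fin k} (hij : j < i) {w : W}
    (hw : w ∈ loweringSpan e H) : e i.succ j.succ w ∈ loweringSpan e H :=
  apply_mem_of_forall_generator _ (fun _ h =>
    Submodule.subset_span (LoweringWord.step i j hij _ h)) hw

theorem lower_zero_mem_loweringSpan (he : GlRelations e) (q : Fin k) {w : W}
    (hw : w ∈ loweringSpan e H) : e q.succ 0 w ∈ loweringSpan e H := by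
  refine apply_mem_of_forall_generator _ (fun w hw => ?_) hw
  induction hw generalizing q with
  | ofAbelian w hw => exact Submodule.subset_span (.ofAbelian _ (.step q w hw))
  | step i j hij w hw ih =>
    rw [he, if_neg (Fin.succ_ne_zero i).symm, zero_sub]
    refine add_mem (lower_mem_loweringSpan hij (ih q)) (neg_mem ?_)
    split_ifs
    · exact ih i
    · exact zero_mem _

theorem ite_sub_ite_mem {N : Submodule ℂ W} {p q : Prop} [Decidable p] [Decidable q] {v w : W}
    (hv : v ∈ N) (hw : w ∈ N) : (if p then v else 0) - (if q then w else 0) ∈ N := by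
  refine sub_mem ?_ ?_ <;> split_ifs <;> first | assumption | exact zero_mem _

theorem apply_mem_loweringSpan (he : GlRelations e) (hH : ∀ h ∈ H, IsHighestWeight e ν h)
    (a b : Fin (k + 1)) {w : W} (hw : w ∈ loweringSpan e H) : e a b w ∈ loweringSpan e H := by
  refine apply_mem_of_forall_generator _ (fun w hw => ?_) hw
  induction hw generalizing a b with
  | ofAbelian w hw =>
    induction hw generalizing a b with
    | base h hh =>
      rcases lt_trichotomy a b with hab | rfl | hab
      · rw [(hH h hh).raise a b hab]; exact zero_mem _
      · rw [(hH h hh).weight]; exact Submodule.smul_mem _ _ (mem_loweringSpan_of_mem hh)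
      · obtain ⟨a, rfl⟩ := Fin.exists_succ_eq.2 (Fin.ne_zero_of_lt hab)
        refine Fin.cases (fun _ => ?_) (fun b hab => ?_) b hab
        · exact lower_zero_mem_loweringSpan he a (mem_loweringSpan_of_mem hh)
        · exact lower_mem_loweringSpan (Fin.succ_lt_succ_iff.1 hab) (mem_loweringSpan_of_mem hh)
    | step q w hw ih =>
      rw [he]
      exact add_mem (lower_zero_mem_loweringSpan he q (ih a b)) (ite_sub_ite_mem (ih _ _) (ih _ _))
  | step i j hij w hw ih =>
    rw [he]
    exact add_mem (lower_mem_loweringSpan hij (ih a b)) (ite_sub_ite_mem (ih _ _) (ih _ _))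

/-- The span of the vectors `e i j y` with `j < i` and `y ∈ N`. -/
def negativePart (e : Fin n → Fin n → Module.End ℂ W) (N : Submodule ℂ W) : Submodule ℂ W :=
  Submodule.span ℂ {w | ∃ i j : Fin n, j < i ∧ ∃ y ∈ N, w = e i j y}

theorem loweringSpan_le_sup_negativePart :
    loweringSpan e H ≤ H ⊔ negativePart e (loweringSpan e H) := by
  refine Submodule.span_le.2 fun w hw => ?_
  have key : ∀ w, AbelianWord e H w → w ∈ H ⊔ negativePart e (loweringSpan e H) := by
    intro w hw
    cases hw with
    | base h hh => exact Submodule.mem_sup_left hh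
    | step q w hw => exact Submodule.mem_sup_right (Submodule.subset_span
        ⟨_, _, Fin.succ_pos q, w, Submodule.subset_span (.ofAbelian _ hw), rfl⟩)
  cases hw with
  | ofAbelian w hw => exact key w hw
  | step i j hij w hw => exact Submodule.mem_sup_right (Submodule.subset_span
        ⟨_, _, Fin.succ_lt_succ_iff.2 hij, w, Submodule.subset_span hw, rfl⟩)

/-! ### The subspace `n⁻ N` for `gl(k)` and the operators `e k 0 ^ d_k ⋯ e 1 0 ^ d_1` -/

/-- The span of the vectors `e q i y` with `1 ≤ i < q ≤ j` and `y ∈ N` (the indices `q`, `i` are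
shifted by one in the encoding). For `j = k` this is `n⁻ N`, with `n⁻` the strictly lower
triangular part of the subalgebra `gl(k)` of `gl(k+1)`. -/
def lowerPart (e : Fin (k + 1) → Fin (k + 1) → Module.End ℂ W) (N : Submodule ℂ W) (j : ℕ) :
    Submodule ℂ W :=
  Submodule.span ℂ
    {w | ∃ q i : Fin k, i < q ∧ (q : ℕ) < j ∧ ∃ y ∈ N, w = e q.succ i.succ y}

theorem mem_lowerPart {N : Submodule ℂ W} {j : ℕ} {q i : Fin k} (hiq : i < q) (hq : (q : ℕ) < j)
    {y : W} (hy : y ∈ N) : e q.succ i.succ y ∈ lowerPart e N j :=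
  Submodule.subset_span ⟨q, i, hiq, hq, y, hy, rfl⟩

theorem lowerPart_mono {N : Submodule ℂ W} {j j' : ℕ} (hj : j ≤ j') :
    lowerPart e N j ≤ lowerPart e N j' :=
  Submodule.span_mono fun _ ⟨q, i, hiq, hq, h⟩ => ⟨q, i, hiq, hq.trans_le hj, h⟩

/-- The operator `e p 0` preserves the lower parts that do not involve larger indices, since
`[e p 0, e q i] = - δ_{ip} e q 0`. -/
theorem lower_zero_mem_lowerPart (he : GlRelations e) {N : Submodule ℂ W}
    (hN : ∀ i j, ∀ y ∈ N, e i j y ∈ N) (p : Fin k) {w : W} (hw : w ∈ lowerPart e N (p + 1)) :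
    e p.succ 0 w ∈ lowerPart e N (p + 1) := by
  refine apply_mem_of_forall_generator _ ?_ hw
  rintro _ ⟨q, i, hiq, hq, y, hy, rfl⟩
  rw [he, if_neg (Fin.succ_ne_zero q).symm, if_neg, sub_zero, add_zero]
  · exact mem_lowerPart hiq hq (hN _ _ y hy)
  · rw [Fin.succ_inj]
    rintro rfl
    exact absurd hiq (by rw [Fin.lt_def]; omega)

/-- The product `f (j-1) * ⋯ * f 1 * f 0`, where factors with an index outside of `Fin k` are
omitted. -/
def orderedProd {R : Type*} [Monoid R] (f : Fin k → R) : ℕ → R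
  | 0 => 1
  | j + 1 => (if hj : j < k then f ⟨j, hj⟩ else 1) * orderedProd f j

theorem commute_orderedProd {R : Type*} [Monoid R] {x : R} {f : Fin k → R}
    (h : ∀ p, Commute x (f p)) (j : ℕ) : Commute x (orderedProd f j) := by
  induction j with
  | zero => exact Commute.one_right x
  | succ j ih =>
    rw [orderedProd]
    refine Commute.mul_right ?_ ih
    split_ifs
    · exact h _
    · exact Commute.one_right x

theorem orderedProd_update {R : Type*} [Monoid R] {x : R} {f : Fin k → R}
    (h : ∀ p, Commute x (f p)) (q : Fin k) (j : ℕ) :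
    orderedProd (Function.update f q (x * f q)) j =
      if (q : ℕ) < j then x * orderedProd f j else orderedProd f j := by
  induction j with
  | zero => simp [orderedProd]
  | succ j ih =>
    rw [orderedProd, orderedProd, ih]
    by_cases hj : j < k
    · rw [dif_pos hj, dif_pos hj]
      by_cases hq : q = ⟨j, hj⟩
      · subst hq; simp [mul_assoc]
      · rw [Function.update_of_ne (Ne.symm hq)]
        have hq' : (q : ℕ) ≠ j := fun h => hq (Fin.ext h)
        have : (q : ℕ) < j ↔ (q : ℕ) < j + 1 := by omega
        simp only [this]
        split_ifs
        · rw [← mul_assoc, ← (h _).eq, mul_assoc]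
        · rfl
    · have : (q : ℕ) < j := by omega
      have h' : (q : ℕ) < j + 1 := by omega
      simp [hj, this, h']

/-- The operator `e j 0 ^ d_j * ⋯ * e 1 0 ^ d_1`, where the exponent `d_p` of `e p 0` is the entry
`p - 1` of `d : Fin k → ℕ`. -/
def lowerPow (e : Fin (k + 1) → Fin (k + 1) → Module.End ℂ W) (d : Fin k → ℕ) (j : ℕ) :
    Module.End ℂ W :=
  orderedProd (fun p => e p.succ 0 ^ d p) j

theorem lowerPow_succ_apply (d : Fin k → ℕ) (j : ℕ) (v : W) :
    lowerPow e d (j + 1) v =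
      (if hj : j < k then e (Fin.succ ⟨j, hj⟩) 0 ^ d ⟨j, hj⟩ else 1) (lowerPow e d j v) :=
  rfl

theorem commute_lower_zero (he : GlRelations e) (p q : Fin k) :
    Commute (e p.succ 0) (e q.succ 0) :=
  LinearMap.ext fun v => by
    simpa [(Fin.succ_ne_zero _).symm] using he p.succ 0 q.succ 0 v

theorem lowerPow_add_single (he : GlRelations e) (d : Fin k → ℕ) (q : Fin k) :
    lowerPow e (d + Pi.single q 1) k = e q.succ 0 * lowerPow e d k := by
  have h := orderedProd_update (f := fun p : Fin k => e p.succ 0 ^ d p) (x := e q.succ 0)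
    (fun p => (commute_lower_zero he q p).pow_right _) q k
  rw [if_pos q.2] at h
  rw [lowerPow, lowerPow, ← h]
  congr 1
  funext p
  by_cases hp : p = q
  · subst hp; simp [pow_succ']
  · simp [hp]

theorem lowerPow_eq_pow_mul (he : GlRelations e) (d : Fin k → ℕ) (q : Fin k) :
    lowerPow e d k = e q.succ 0 ^ d q * lowerPow e (Function.update d q 0) k := by
  have key : ∀ t : ℕ, lowerPow e (Function.update d q t) k
      = e q.succ 0 ^ t * lowerPow e (Function.update d q 0) k := by
    intro t
    induction t with
    | zero => simp
    | succ t ih =>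
      rw [pow_succ', mul_assoc, ← ih, ← lowerPow_add_single he]
      congr 1
      funext p
      by_cases hp : p = q
      · subst hp; simp
      · simp [hp]
  simpa using key (d q)

theorem lowerPow_zero : lowerPow e (0 : Fin k → ℕ) k = 1 := by
  have : ∀ j, lowerPow e (0 : Fin k → ℕ) j = 1 := by
    intro j
    induction j with
    | zero => rfl
    | succ j ih => rw [lowerPow, orderedProd, ← lowerPow, ih]; simp
  exact this k

theorem loweringSpan_le_sup_lowerPow (he : GlRelations e) :
    loweringSpan e H ≤
      lowerPart e (loweringSpan e H) k ⊔ ⨆ d : Fin k → ℕ, H.map (lowerPow e d k) := by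
  refine Submodule.span_le.2 fun w hw => ?_
  cases hw with
  | step i j hij w hw =>
    exact Submodule.mem_sup_left (mem_lowerPart hij i.2 (Submodule.subset_span hw))
  | ofAbelian w hw =>
    refine Submodule.mem_sup_right ?_
    obtain ⟨d, h, hh, rfl⟩ : ∃ d : Fin k → ℕ, ∃ h ∈ H, w = lowerPow e d k h := by
      induction hw with
      | base h hh => exact ⟨0, h, hh, by rw [lowerPow_zero]; rfl⟩
      | step q w hw ih =>
        obtain ⟨d, h, hh, rfl⟩ := ih
        exact ⟨d + Pi.single q 1, h, hh, by rw [lowerPow_add_single he]; rfl⟩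
    exact Submodule.mem_iSup_of_mem d ⟨h, hh, rfl⟩

theorem lowerPow_apply_mem {N : Submodule ℂ W} (hN : ∀ i j, ∀ y ∈ N, e i j y ∈ N) (d : Fin k → ℕ)
    (j : ℕ) {v : W} (hv : v ∈ N) : lowerPow e d j v ∈ N := by
  have hpow : ∀ (q : Fin k) (t : ℕ), ∀ y ∈ N, (e q.succ 0 ^ t) y ∈ N := by
    intro q t y hy
    induction t with
    | zero => exact hy
    | succ t ih => rw [pow_succ']; exact hN _ _ _ ih
  induction j with
  | zero => exact hv
  | succ j ih =>
    rw [lowerPow, orderedProd, ← lowerPow]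
    split_ifs
    · exact hpow _ _ _ ih
    · exact ih

theorem mul_pow_succ_of_commutator {R : Type*} [Ring R] {f y z : R} (hfy : f * y = y * f + z)
    (hyz : Commute y z) (a : ℕ) : f * y ^ (a + 1) = y ^ (a + 1) * f + (a + 1 : ℕ) • (y ^ a * z) := by
  induction a with
  | zero => simpa using hfy
  | succ a ih =>
    rw [succ_nsmul' _ (a + 1), pow_succ y (a + 1), ← mul_assoc, ih, add_mul, mul_assoc _ f,
      hfy, smul_mul_assoc, mul_assoc _ z, ← hyz.eq, ← mul_assoc, ← pow_succ, mul_add, ← mul_assoc,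
      add_assoc]

/-- If `[f, y] = z` and `z` commutes with `f` and `y`, then `y ^ a * z ^ c` agrees up to a nonzero
factor with `y ^ (a + c) * f ^ c` modulo the image of `f`. -/
theorem pow_mul_pow_apply_mem {f y z : Module.End ℂ W} (hfy : f * y = y * f + z)
    (hyz : Commute y z) (hfz : Commute f z) {N K : Submodule ℂ W} (hf : ∀ v ∈ N, f v ∈ N)
    (hy : ∀ v ∈ N, y v ∈ N) (hz : ∀ v ∈ N, z v ∈ N) (hK : ∀ v ∈ N, f v ∈ K) (c : ℕ) :
    ∀ (a b : ℕ) (v : W), v ∈ N → (f ^ c) v = 0 → (y ^ a * z ^ (b + c)) v ∈ K := by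
  have hpow : ∀ g : Module.End ℂ W, (∀ v ∈ N, g v ∈ N) → ∀ (t : ℕ), ∀ v ∈ N, (g ^ t) v ∈ N := by
    intro g hg t v hv
    induction t with
    | zero => exact hv
    | succ t ih => rw [pow_succ']; exact hg _ ih
  induction c with
  | zero =>
    intro a b v _ h0
    rw [pow_zero, Module.End.one_apply] at h0
    rw [h0, map_zero]; exact zero_mem _
  | succ c ih =>
    intro a b v hv h0
    have h1 := ih (a + 1) b (f v) (hf v hv) (by rwa [pow_succ] at h0)
    have h2 : (y ^ (a + 1) * z ^ (b + c)) (f v) =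
        f ((y ^ (a + 1) * z ^ (b + c)) v)
          - ((a + 1 : ℕ) : ℂ) • (y ^ a * z ^ (b + (c + 1))) v := by
      have : f * (y ^ (a + 1) * z ^ (b + c)) = y ^ (a + 1) * z ^ (b + c) * f
          + (a + 1 : ℕ) • (y ^ a * z ^ (b + (c + 1))) := by
        rw [← mul_assoc, mul_pow_succ_of_commutator hfy hyz, add_mul, mul_assoc,
          (hfz.pow_right _).eq, ← mul_assoc, smul_mul_assoc, mul_assoc _ z, ← pow_succ']
        rfl
      have h3 := congrArg (fun g : Module.End ℂ W => g v) this
      simp only [LinearMap.add_apply, Module.End.mul_apply, LinearMap.smul_apply] at h3 ⊢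
      rw [h3, Nat.cast_smul_eq_nsmul, add_sub_cancel_right]
    rw [h2] at h1
    have h3 := (Submodule.sub_mem_iff_right K (hK ((y ^ (a + 1) * z ^ (b + c)) v) (by
      rw [Module.End.mul_apply]; exact hpow y hy _ _ (hpow z hz _ _ hv)))).1 h1
    exact (Submodule.smul_mem_iff K (by exact_mod_cast Nat.succ_ne_zero a)).1 h3

/-- The `sl₂`-computation `E F^{t+1} h = (t+1) (ν_i - ν_j - t) F^t h` on a highest weight vector. -/
theorem raise_lower_pow {e : Fin n → Fin n → Module.End ℂ W} (he : GlRelations e)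
    {ν : Fin n → ℂ} {i j : Fin n} (hij : i < j) {h : W} (hh : IsHighestWeight e ν h) (t : ℕ) :
    e i j ((e j i ^ (t + 1)) h) = ((t + 1) * (ν i - ν j - t)) • (e j i ^ t) h := by
  have hw : ∀ t : ℕ, e i i ((e j i ^ t) h) = (ν i - t) • (e j i ^ t) h ∧
      e j j ((e j i ^ t) h) = (ν j + t) • (e j i ^ t) h := by
    intro t
    induction t with
    | zero => simp [hh.weight]
    | succ t ih =>
      rw [pow_succ', Module.End.mul_apply, he i i j i, he j j j i, ih.1, ih.2]
      simp only [hij.ne, if_true, if_false, map_smul]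
      constructor <;> push_cast <;> module
  induction t with
  | zero =>
    rw [zero_add, pow_one, he, hh.raise i j hij, hh.weight, hh.weight]
    simp [sub_smul]
  | succ t ih =>
    rw [pow_succ', Module.End.mul_apply, he, ih, (hw (t + 1)).1, (hw (t + 1)).2, map_smul,
      ← Module.End.mul_apply (e j i), ← pow_succ']
    simp only [if_true]
    push_cast
    module

end generic

/-! ### The operators `⟨u_i, ∂_j⟩` -/

section operators

variable {n m : ℕ}

theorem glRelations_dotUD : GlRelations (dotUD (n := n) (m := m)) := fun i j l r P => by
  rw [← dotUD_comm]; abel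

theorem dotUD_mul (i j : Fin n) (P Q : VPoly n m) :
    dotUD i j (P * Q) = P * dotUD i j Q + Q * dotUD i j P := by
  simp only [dotUD_apply, Derivation.leibniz, smul_eq_mul, Finset.mul_sum,
    ← Finset.sum_add_distrib]
  exact Finset.sum_congr rfl fun a _ => by ring

theorem dotUD_X (i j : Fin n) (p : Fin n × Fin m) :
    dotUD i j (X p) = if p.1 = j then X (i, p.2) else 0 := by
  rw [dotUD_apply]
  split_ifs with h
  · subst h
    rw [Finset.sum_eq_single p.2]
    · simp
    · intro b _ hb
      rw [pderiv_X_of_ne (fun h => hb (by rw [h])), mul_zero]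
    · simp
  · refine Finset.sum_eq_zero fun a _ => ?_
    rw [pderiv_X_of_ne (fun h' => h (by rw [h'])), mul_zero]

theorem dotUD_C (i j : Fin n) (c : ℂ) : dotUD i j (C c : VPoly n m) = 0 := by
  simp [dotUD_apply]

theorem dotUD_one (i j : Fin n) : dotUD i j (1 : VPoly n m) = 0 := dotUD_C i j 1

/-- `⟨u_i, ∂_j⟩` as a derivation. -/
noncomputable def dotUDDerivation (i j : Fin n) : Derivation ℂ (VPoly n m) (VPoly n m) :=
  Derivation.mk' (dotUD i j) (fun P Q => by simp [dotUD_mul])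

theorem dotUD_pow (i j : Fin n) (P : VPoly n m) (t : ℕ) :
    dotUD i j (P ^ t) = t • (P ^ (t - 1) * dotUD i j P) := by
  exact (dotUDDerivation i j).leibniz_pow P t

theorem opE_of_ne {i j : Fin n} (hij : i ≠ j) : opE (m := m) i j = dotUD i j := by
  simp [opE, hij]

theorem opE_self_apply (i : Fin n) (P : VPoly n m) :
    opE i i P = dotUD i i P + ((m : ℂ) / 2) • P := by
  simp [opE]

theorem opE_apply_mem {N : Submodule ℂ (VPoly n m)}
    (hN : ∀ i j, ∀ P ∈ N, dotUD i j P ∈ N) (i j : Fin n) {P : VPoly n m} (hP : P ∈ N) :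
    opE i j P ∈ N := by
  by_cases hij : i = j
  · subst hij
    rw [opE_self_apply]
    exact add_mem (hN _ _ _ hP) (Submodule.smul_mem _ _ hP)
  · rw [opE_of_ne hij]; exact hN _ _ _ hP

theorem pderiv_dotUD (p : Fin n × Fin m) (i j : Fin n) (P : VPoly n m) :
    pderiv p (dotUD i j P) =
      dotUD i j (pderiv p P) + if p.1 = i then pderiv (j, p.2) P else 0 := by
  rw [dotUD_apply, dotUD_apply, map_sum]
  simp only [Derivation.leibniz, smul_eq_mul, Finset.sum_add_distrib, pderiv_comm_apply p]
  congr 1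
  split_ifs with h
  · subst h
    rw [Finset.sum_eq_single p.2]
    · simp
    · intro b _ hb
      rw [pderiv_X_of_ne (fun h => hb (by rw [← h])), mul_zero]
    · simp
  · refine Finset.sum_eq_zero fun a _ => ?_
    rw [pderiv_X_of_ne (fun h' => h (by rw [← h'])), mul_zero]

theorem dotDD_apply (i j : Fin n) (P : VPoly n m) :
    dotDD i j P = ∑ a : Fin m, pderiv (i, a) (pderiv (j, a) P) := by
  simp [dotDD]

theorem dotDD_dotUD (a b i j : Fin n) (P : VPoly n m) :
    dotDD a b (dotUD i j P) = dotUD i j (dotDD a b P)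
      + ((if a = i then dotDD j b P else 0) + if b = i then dotDD a j P else 0) := by
  simp only [dotDD_apply, pderiv_dotUD, map_add, Finset.sum_add_distrib, map_sum]
  rw [add_assoc]
  congr 2
  · split_ifs <;> simp
  · split_ifs <;> simp

/-- The polynomials annihilated by all `⟨∂_i, ∂_j⟩`. -/
noncomputable def harmonics (n m : ℕ) : Submodule ℂ (VPoly n m) :=
  ⨅ (i : Fin n) (j : Fin n), LinearMap.ker (dotDD (m := m) i j)

theorem mem_harmonics {P : VPoly n m} : P ∈ harmonics n m ↔ ∀ i j, dotDD i j P = 0 := by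
  simp [harmonics]

theorem dotUD_mem_harmonics (i j : Fin n) {P : VPoly n m} (hP : P ∈ harmonics n m) :
    dotUD i j P ∈ harmonics n m := by
  rw [mem_harmonics] at *
  intro a b
  simp [dotDD_dotUD, hP]

/-! ### Homogeneity and Euler operators -/

theorem dotUD_self_monomial (i : Fin n) (α : Fin n × Fin m →₀ ℕ) (c : ℂ) :
    dotUD i i (monomial α c) = ((∑ a, α (i, a) : ℕ) : ℂ) • monomial α c := by
  rw [dotUD_apply, Nat.cast_sum, Finset.sum_smul]
  refine Finset.sum_congr rfl fun a _ => ?_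
  rw [X_mul_pderiv_monomial, Nat.cast_smul_eq_nsmul]

theorem coeff_dotUD_self (i : Fin n) (P : VPoly n m) (α : Fin n × Fin m →₀ ℕ) :
    coeff α (dotUD i i P) = ((∑ a, α (i, a) : ℕ) : ℂ) * coeff α P := by
  classical
  induction P using MvPolynomial.induction_on' with
  | monomial β c =>
    rw [dotUD_self_monomial, coeff_smul, coeff_monomial, smul_eq_mul]
    split_ifs with h
    · rw [h]
    · simp
  | add P Q hP hQ => rw [map_add, coeff_add, hP, hQ, coeff_add, mul_add]

theorem weight_single_apply (α : Fin n × Fin m →₀ ℕ) (i : Fin n) :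
    Finsupp.weight (fun p : Fin n × Fin m => (Pi.single p.1 1 : Fin n → ℕ)) α i
      = ∑ a, α (i, a) := by
  rw [Finsupp.weight_apply, Finsupp.sum_fintype _ _ (by simp), Finset.sum_apply,
    Fintype.sum_prod_type, Finset.sum_eq_single i]
  · simp
  · intro b _ hb
    simp [Ne.symm hb]
  · simp

/-- Homogeneous polynomials are the joint eigenvectors of the Euler operators. -/
theorem mem_multiHomogeneous_iff {ν : Fin n → ℕ} {P : VPoly n m} :
    P ∈ multiHomogeneous n m ν ↔ ∀ i, dotUD i i P = (ν i : ℂ) • P := by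
  rw [multiHomogeneous, mem_weightedHomogeneousSubmodule, IsWeightedHomogeneous]
  constructor
  · intro h i
    ext α
    rw [coeff_dotUD_self, coeff_smul, smul_eq_mul]
    by_cases hα : coeff α P = 0
    · rw [hα, mul_zero, mul_zero]
    · rw [← h hα, weight_single_apply]
  · intro h α hα
    funext i
    have h1 := congrArg (coeff α) (h i)
    rw [coeff_dotUD_self, coeff_smul, smul_eq_mul] at h1
    rw [weight_single_apply]
    exact_mod_cast mul_right_cancel₀ hα h1

theorem mem_simplicialHarmonics_iff {ν : Fin n → ℕ} {P : VPoly n m} :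
    P ∈ simplicialHarmonics n m ν ↔
      P ∈ harmonics n m ∧ IsHighestWeight dotUD (fun i => (ν i : ℂ)) P := by
  rw [simplicialHarmonics, Submodule.mem_inf, Submodule.mem_inf, mem_multiHomogeneous_iff,
    ← harmonics]
  constructor
  · rintro ⟨⟨h1, h2⟩, h3⟩
    refine ⟨h2, ⟨fun i j hij => ?_, h1⟩⟩
    simp only [Submodule.mem_iInf, LinearMap.mem_ker] at h3
    exact h3 i j hij
  · rintro ⟨h2, h3, h1⟩
    refine ⟨⟨h1, h2⟩, ?_⟩
    simpa only [Submodule.mem_iInf, LinearMap.mem_ker] using h3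

/-! ### The Fischer inner product -/

/-- The Fischer inner product `P ↦ ∑ α! P_α conj Q_α`, conjugate linear in `Q`. -/
noncomputable def fischer (Q : VPoly n m) : VPoly n m →ₗ[ℂ] ℂ :=
  (basisMonomials (Fin n × Fin m) ℂ).constr ℂ
    (fun α => ((α.prod fun _ t => t.factorial : ℕ) : ℂ) * starRingEnd ℂ (coeff α Q))

theorem fischer_monomial (Q : VPoly n m) (α : Fin n × Fin m →₀ ℕ) :
    fischer Q (monomial α 1) =
      ((α.prod fun _ t => t.factorial : ℕ) : ℂ) * starRingEnd ℂ (coeff α Q) := by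
  have := (basisMonomials (Fin n × Fin m) ℂ).constr_basis ℂ
    (fun α => ((α.prod fun _ t => t.factorial : ℕ) : ℂ) * starRingEnd ℂ (coeff α Q)) α
  rwa [coe_basisMonomials] at this

theorem fischer_ext {Q Q' : VPoly n m} {f g : Module.End ℂ (VPoly n m)}
    (h : ∀ α, fischer Q (f (monomial α 1)) = fischer Q' (g (monomial α 1))) (P : VPoly n m) :
    fischer Q (f P) = fischer Q' (g P) := by
  have : fischer Q ∘ₗ f = fischer Q' ∘ₗ g :=
    (basisMonomials (Fin n × Fin m) ℂ).ext fun α => by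
      rw [coe_basisMonomials]; exact h α
  exact LinearMap.congr_fun this P

theorem prod_factorial_add_single (α : Fin n × Fin m →₀ ℕ) (s : Fin n × Fin m) :
    ((α + Finsupp.single s 1).prod fun _ t => t.factorial) =
      (α s + 1) * α.prod fun _ t => t.factorial := by
  rw [Finsupp.prod_fintype _ _ (by simp), Finsupp.prod_fintype _ _ (by simp),
    ← Finset.mul_prod_erase _ _ (Finset.mem_univ s),
    ← Finset.mul_prod_erase (Finset.univ) (fun i => (α i).factorial) (Finset.mem_univ s),
    ← mul_assoc]
  congr 1
  · simp [Nat.factorial_succ]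
  · refine Finset.prod_congr rfl fun i hi => ?_
    simp [Finsupp.single_eq_of_ne (Finset.ne_of_mem_erase hi)]

theorem fischer_X_mul (s : Fin n × Fin m) (Q P : VPoly n m) :
    fischer Q (X s * P) = fischer (pderiv s Q) P := by
  refine fischer_ext (f := LinearMap.mulLeft ℂ (X s)) (g := LinearMap.id) (fun α => ?_) P
  rw [LinearMap.mulLeft_apply, LinearMap.id_apply, X, monomial_mul, one_mul, fischer_monomial,
    fischer_monomial, coeff_pderiv, add_comm, prod_factorial_add_single, map_mul,
    map_add, map_one, Complex.conj_natCast]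
  push_cast
  ring

theorem fischer_pderiv (s : Fin n × Fin m) (Q P : VPoly n m) :
    fischer Q (pderiv s P) = fischer (X s * Q) P := by
  refine fischer_ext (f := (pderiv s).toLinearMap) (g := LinearMap.id) (fun α => ?_) P
  rw [Derivation.coeFn_coe, LinearMap.id_apply, pderiv_monomial,
    fischer_monomial, coeff_X_mul', one_mul]
  split_ifs with h
  · obtain ⟨β, rfl⟩ : ∃ β, α = β + Finsupp.single s 1 :=
      ⟨α - Finsupp.single s 1, (tsub_add_cancel_of_le (by
        rw [Finsupp.single_le_iff]
        exact Nat.one_le_iff_ne_zero.2 (Finsupp.mem_support_iff.1 h))).symm⟩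
    rw [add_tsub_cancel_right, prod_factorial_add_single, ← mul_one (((_ : ℕ) : ℂ)),
      ← smul_eq_mul, ← smul_monomial, map_smul, fischer_monomial]
    simp
    ring
  · rw [Finsupp.notMem_support_iff.1 h]
    simp

theorem fischer_eq_sum (Q P : VPoly n m) :
    fischer Q P = ∑ α ∈ P.support,
      coeff α P * (((α.prod fun _ t => t.factorial : ℕ) : ℂ) * starRingEnd ℂ (coeff α Q)) := by
  conv_lhs => rw [P.as_sum]
  rw [map_sum]
  refine Finset.sum_congr rfl fun α _ => ?_
  rw [← fischer_monomial, ← smul_eq_mul, ← map_smul, smul_monomial, smul_eq_mul, mul_one]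

theorem fischer_eq_sum_of_subset {Q P : VPoly n m} {s : Finset (Fin n × Fin m →₀ ℕ)}
    (hs : P.support ⊆ s) : fischer Q P = ∑ α ∈ s,
      coeff α P * (((α.prod fun _ t => t.factorial : ℕ) : ℂ) * starRingEnd ℂ (coeff α Q)) := by
  rw [fischer_eq_sum]
  refine Finset.sum_subset hs fun α _ hα => ?_
  rw [notMem_support_iff.1 hα, zero_mul]

theorem conj_fischer (Q P : VPoly n m) : starRingEnd ℂ (fischer Q P) = fischer P Q := by
  classical
  rw [fischer_eq_sum_of_subset (Finset.subset_union_left (s₂ := Q.support)),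
    fischer_eq_sum_of_subset (Finset.subset_union_right (s₁ := P.support)), map_sum]
  refine Finset.sum_congr rfl fun α _ => ?_
  rw [map_mul, map_mul, Complex.conj_conj, Complex.conj_natCast]
  ring

theorem fischer_eq_zero_symm {Q P : VPoly n m} (h : fischer Q P = 0) : fischer P Q = 0 := by
  rw [← conj_fischer, h, map_zero]

theorem fischer_zero_left (P : VPoly n m) : fischer 0 P = 0 := by
  simp [fischer_eq_sum]

theorem fischer_dotUD (i j : Fin n) (Q P : VPoly n m) :
    fischer Q (dotUD i j P) = fischer (dotUD j i Q) P := by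
  have hadd : ∀ (s : Finset (Fin m)) (f : Fin m → VPoly n m),
      fischer (∑ a ∈ s, f a) P = ∑ a ∈ s, fischer (f a) P := by
    intro s f
    simp only [fischer_eq_sum, coeff_sum, map_sum, Finset.mul_sum]
    rw [Finset.sum_comm]
  rw [dotUD_apply, dotUD_apply, map_sum, hadd]
  refine Finset.sum_congr rfl fun a _ => ?_
  rw [fischer_X_mul, fischer_pderiv]

theorem eq_zero_of_fischer_self {P : VPoly n m} (h : fischer P P = 0) : P = 0 := by
  by_contra hP
  have key : ∀ α, coeff α P * (((α.prod fun _ t => t.factorial : ℕ) : ℂ)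
      * starRingEnd ℂ (coeff α P)) =
      (((α.prod fun _ t => t.factorial : ℕ) * Complex.normSq (coeff α P) : ℝ) : ℂ) := by
    intro α
    rw [mul_left_comm, Complex.mul_conj, Complex.ofReal_mul, Complex.ofReal_natCast]
  have hpos : 0 < ∑ α ∈ P.support,
      ((α.prod fun _ t => t.factorial : ℕ) * Complex.normSq (coeff α P) : ℝ) := by
    refine Finset.sum_pos (fun α hα => mul_pos ?_ (Complex.normSq_pos.2 (mem_support_iff.1 hα)))
      (support_nonempty.2 hP)
    exact_mod_cast Finset.prod_pos fun _ _ => Nat.factorial_pos _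
  rw [fischer_eq_sum, Finset.sum_congr rfl fun α _ => key α, ← Complex.ofReal_sum] at h
  exact hpos.ne' (by exact_mod_cast h)

theorem fischer_eq_zero_of_mem_span {s : Set (VPoly n m)} {Q P : VPoly n m}
    (h : ∀ w ∈ s, fischer Q w = 0) (hP : P ∈ Submodule.span ℂ s) : fischer Q P = 0 := by
  have : Submodule.span ℂ s ≤ LinearMap.ker (fischer Q) := Submodule.span_le.2 h
  exact this hP

theorem fischer_dotUD_eq_zero {i j : Fin n} {Q : VPoly n m} (hQ : dotUD j i Q = 0)
    (P : VPoly n m) : fischer Q (dotUD i j P) = 0 := by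
  rw [fischer_dotUD, hQ, fischer_zero_left]

end operators

/-! ### Highest weight vectors of `gl(k)` are orthogonal to the image of lowering operators -/

section gl

variable {k m : ℕ}

/-- The highest weight vectors of the subalgebra `gl(k)` on the indices `1, …, k`: the
polynomials annihilated by `⟨u_i, ∂_j⟩` for `1 ≤ i < j`. -/
noncomputable def subHighest (k m : ℕ) : Submodule ℂ (VPoly (k + 1) m) :=
  ⨅ (i : Fin k) (j : Fin k) (_ : i < j), LinearMap.ker (dotUD (m := m) i.succ j.succ)

theorem mem_subHighest {P : VPoly (k + 1) m} :
    P ∈ subHighest k m ↔ ∀ i j : Fin k, i < j → dotUD i.succ j.succ P = 0 := by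
  simp [subHighest]

theorem fischer_lowerPart {Q : VPoly (k + 1) m} (hQ : Q ∈ subHighest k m)
    {N : Submodule ℂ (VPoly (k + 1) m)} {j : ℕ} {P : VPoly (k + 1) m}
    (hP : P ∈ lowerPart dotUD N j) : fischer Q P = 0 := by
  refine fischer_eq_zero_of_mem_span ?_ hP
  rintro _ ⟨q, i, hiq, _, y, _, rfl⟩
  exact fischer_dotUD_eq_zero (mem_subHighest.1 hQ i q hiq) y

/-- Highest weight vectors of `gl(k)` are orthogonal to the image of `n⁻`. -/
theorem eq_zero_of_mem_subHighest_of_mem_lowerPart {P : VPoly (k + 1) m}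
    (hP : P ∈ subHighest k m) {N : Submodule ℂ (VPoly (k + 1) m)} {j : ℕ}
    (hP' : P ∈ lowerPart dotUD N j) : P = 0 :=
  eq_zero_of_fischer_self (fischer_lowerPart hP hP')

theorem dotUD_pow_eq_zero {n : ℕ} {ν : Fin n → ℕ} {i j : Fin n} (hij : i < j)
    (hν : ν j ≤ ν i) {h : VPoly n m} (hh : IsHighestWeight dotUD (fun i => (ν i : ℂ)) h) :
    (dotUD j i ^ (ν i - ν j + 1)) h = 0 := by
  refine eq_zero_of_fischer_self ?_
  nth_rw 2 [pow_succ']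
  rw [Module.End.mul_apply, fischer_dotUD, raise_lower_pow glRelations_dotUD hij hh]
  rw [Nat.cast_sub hν, sub_self, mul_zero, zero_smul, fischer_zero_left]

/-- The vectors `lowerPow d h` that violate the betweenness conditions lie in `n⁻ N`. -/
theorem lowerPow_mem_lowerPart {μ : Fin (k + 1) → ℕ} (hμ : Antitone μ) {d : Fin k → ℕ}
    (hd : ¬ Betweenness μ d) {N : Submodule ℂ (VPoly (k + 1) m)}
    (hN : ∀ i j, ∀ y ∈ N, dotUD i j y ∈ N) {h : VPoly (k + 1) m} (hh : h ∈ N)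
    (hh' : IsHighestWeight dotUD (fun i => (μ i : ℂ)) h) :
    lowerPow dotUD d k h ∈ lowerPart dotUD N k := by
  have he := glRelations_dotUD (n := k + 1) (m := m)
  obtain ⟨p, hp⟩ : ∃ p : Fin k, μ p.castSucc < μ p.succ + d p := by
    simpa [Betweenness] using hd
  have hp1 := hμ (Fin.castSucc_lt_succ (i := p)).le
  have hp2 : μ p.castSucc - μ p.succ + 1 ≤ d p := by omega
  have h0 := dotUD_pow_eq_zero (Fin.castSucc_lt_succ (i := p)) hp1 hh'
  set c := μ p.castSucc - μ p.succ + 1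
  obtain ⟨b, hb⟩ := Nat.exists_eq_add_of_le' hp2
  rw [lowerPow_eq_pow_mul he d p]
  by_cases hp0 : (p : ℕ) = 0
  · -- the operator `e 1 0` itself is nilpotent on `h`
    have hp0' : p.castSucc = 0 := Fin.ext hp0
    rw [hp0'] at h0
    have hcomm : Commute (dotUD (m := m) p.succ 0 ^ d p)
        (lowerPow dotUD (Function.update d p 0) k) :=
      commute_orderedProd (fun q => ((commute_lower_zero he p q).pow_pow _ _)) k
    rw [hcomm.eq, hb, pow_add, Module.End.mul_apply, Module.End.mul_apply, h0, map_zero, map_zero]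
    exact zero_mem _
  · obtain ⟨q, hq⟩ : ∃ q : Fin k, p.castSucc = q.succ :=
      ⟨⟨p - 1, by omega⟩, Fin.ext (by simp; omega)⟩
    have hqp : q < p := by
      have := congrArg Fin.val hq
      simp at this
      rw [Fin.lt_def]; omega
    rw [hq] at h0
    set d' := Function.update d p 0
    rw [lowerPow_eq_pow_mul he d' q, ← mul_assoc,
      ← ((commute_lower_zero he q p).pow_pow _ _).eq, Module.End.mul_apply, hb]
    set d'' := Function.update d' q 0
    have hcomm : Commute (dotUD (m := m) p.succ q.succ) (lowerPow dotUD d'' k) := by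
      refine commute_orderedProd (fun r => ?_) k
      by_cases hr : r = q
      · subst hr; simp [d'']
      · refine Commute.pow_right (LinearMap.ext fun v => ?_) _
        have := he p.succ q.succ r.succ 0 v
        rw [if_neg (by rwa [Fin.succ_inj, eq_comm]), if_neg (Fin.succ_ne_zero p).symm] at this
        simpa using this
    refine pow_mul_pow_apply_mem (f := dotUD p.succ q.succ) (N := N) ?_
      (commute_lower_zero he q p) ?_ (hN _ _) (hN _ _) (hN _ _)
      (fun v hv => mem_lowerPart hqp p.2 hv) c _ b _ (lowerPow_apply_mem hN _ _ hh) ?_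
    · refine LinearMap.ext fun v => ?_
      have := he p.succ q.succ q.succ 0 v
      rw [if_pos rfl, if_neg (Fin.succ_ne_zero p).symm] at this
      simpa using this
    · refine LinearMap.ext fun v => ?_
      have := he p.succ q.succ p.succ 0 v
      rw [if_neg (by rw [Fin.succ_inj]; exact hqp.ne), if_neg (Fin.succ_ne_zero p).symm] at this
      simpa using this
    · rw [← Module.End.mul_apply, (hcomm.pow_left c).eq, Module.End.mul_apply, h0, map_zero]

end gl

/-! ### Minors -/

section minors

variable {n m : ℕ} {ι : Type*}

theorem dotUD_prod [DecidableEq ι] (i j : Fin n) (s : Finset ι) (F : ι → VPoly n m) :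
    dotUD i j (∏ a ∈ s, F a) = ∑ a ∈ s, (∏ b ∈ s.erase a, F b) * dotUD i j (F a) := by
  induction s using Finset.induction_on with
  | empty => simp [dotUD_one]
  | insert a s ha ih =>
    rw [Finset.prod_insert ha, dotUD_mul, ih, Finset.sum_insert ha, Finset.erase_insert ha,
      Finset.mul_sum, add_comm]
    congr 1
    refine Finset.sum_congr rfl fun b hb => ?_
    have hab : a ≠ b := fun h => ha (h ▸ hb)
    rw [Finset.erase_insert_of_ne hab, Finset.prod_insert (by simp [ha]), mul_assoc]

theorem dotUD_prod_of_eigen [DecidableEq ι] {i : Fin n} (s : Finset ι)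
    {F : ι → VPoly n m} {c : ι → ℂ}
    (h : ∀ a, dotUD i i (F a) = c a • F a) :
    dotUD i i (∏ a ∈ s, F a) = (∑ a ∈ s, c a) • ∏ a ∈ s, F a := by
  rw [dotUD_prod, Finset.sum_smul]
  refine Finset.sum_congr rfl fun a ha => ?_
  rw [h, mul_smul_comm, mul_comm, Finset.mul_prod_erase _ _ ha]

variable [Fintype ι] [DecidableEq ι]

/-- The minor of the matrix `(u_{i,a})` with rows `f` and columns `g`. -/
noncomputable def minor (f : ι → Fin n) (g : ι → Fin m) : VPoly n m :=
  (Matrix.of fun a b => (X (f a, g b) : VPoly n m)).det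

theorem minor_eq_sum (f : ι → Fin n) (g : ι → Fin m) :
    minor f g = ∑ σ : Equiv.Perm ι, Equiv.Perm.sign σ • ∏ a, (X (f a, g (σ a)) : VPoly n m) := by
  rw [minor, ← Matrix.det_transpose, Matrix.det_apply]
  rfl

theorem dotUD_minor (i j : Fin n) (f : ι → Fin n) (g : ι → Fin m) :
    dotUD i j (minor f g) =
      ∑ a, if f a = j then minor (Function.update f a i) g else 0 := by
  have key : ∀ σ : Equiv.Perm ι, dotUD i j (∏ a, (X (f a, g (σ a)) : VPoly n m)) =
      ∑ a, if f a = j then ∏ b, (X (Function.update f a i b, g (σ b)) : VPoly n m) else 0 := by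
    intro σ
    rw [dotUD_prod]
    refine Finset.sum_congr rfl fun a _ => ?_
    rw [dotUD_X]
    split_ifs
    · rw [← Finset.mul_prod_erase _ _ (Finset.mem_univ a), Function.update_self, mul_comm]
      congr 1
      refine Finset.prod_congr rfl fun b hb => ?_
      rw [Function.update_of_ne (Finset.ne_of_mem_erase hb)]
    · rw [mul_zero]
  rw [minor_eq_sum, map_sum]
  simp only [Units.smul_def, map_zsmul, key, Finset.smul_sum]
  rw [Finset.sum_comm]
  refine Finset.sum_congr rfl fun a _ => ?_
  split_ifs
  · rw [minor_eq_sum]; rfl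
  · simp

theorem minor_eq_zero {f : ι → Fin n} {a b : ι} (hab : a ≠ b) (hf : f a = f b) (g : ι → Fin m) :
    minor f g = 0 :=
  Matrix.det_zero_of_row_eq hab (by funext c; simp [hf])

/-- `⟨u_i, ∂_j⟩` replaces the row `j` of a minor by the row `i`, so it annihilates minors
that do not have a row `j`, or that have a row `i ≠ j`. -/
theorem dotUD_minor_eq_zero {i j : Fin n} (hij : i ≠ j) {f : ι → Fin n} {g : ι → Fin m}
    (h : (∃ a, f a = j) → ∃ a, f a = i) : dotUD i j (minor f g) = 0 := by
  rw [dotUD_minor]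
  refine Finset.sum_eq_zero fun a _ => ?_
  split_ifs with ha
  · obtain ⟨b, hb⟩ := h ⟨a, ha⟩
    have hab : a ≠ b := by rintro rfl; exact hij (hb.symm.trans ha)
    exact minor_eq_zero hab (by simp [Function.update_of_ne hab.symm, hb]) g
  · rfl

theorem dotUD_minor_of_mem {i j : Fin n} {f : ι → Fin n} (hf : f.Injective) {g : ι → Fin m}
    {a : ι} (ha : f a = j) : dotUD i j (minor f g) = minor (Function.update f a i) g := by
  rw [dotUD_minor, Finset.sum_eq_single a, if_pos ha]
  · intro b _ hb
    rw [if_neg fun h => hb (hf (h.trans ha.symm))]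
  · simp

open scoped Classical in
theorem dotUD_self_minor (i : Fin n) {f : ι → Fin n} (hf : f.Injective) (g : ι → Fin m) :
    dotUD i i (minor f g) = (if ∃ a, f a = i then (1 : ℂ) else 0) • minor f g := by
  split_ifs with h
  · obtain ⟨a, rfl⟩ := h
    rw [dotUD_minor_of_mem hf rfl, Function.update_eq_self, one_smul]
  · rw [dotUD_minor, zero_smul]
    exact Finset.sum_eq_zero fun a _ => if_neg fun h' => h ⟨a, h'⟩

theorem dotUD_pow_of_eigen {i : Fin n} {P : VPoly n m} {c : ℂ} (h : dotUD i i P = c • P) (t : ℕ) :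
    dotUD i i (P ^ t) = (t * c) • P ^ t := by
  induction t with
  | zero => simp [dotUD_one]
  | succ t ih =>
    rw [pow_succ, dotUD_mul, ih, h, mul_smul_comm, mul_smul_comm, mul_comm P, ← add_smul]
    push_cast
    congr 1
    ring

theorem dotUD_pow_eq_zero_of_eq_zero {i j : Fin n} {P : VPoly n m} (h : dotUD i j P = 0) (t : ℕ) :
    dotUD i j (P ^ t) = 0 := by
  rw [dotUD_pow, h, mul_zero, smul_zero]

theorem dotUD_mul_eq_zero {i j : Fin n} {P Q : VPoly n m} (hP : dotUD i j P = 0)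
    (hQ : dotUD i j Q = 0) : dotUD i j (P * Q) = 0 := by
  rw [dotUD_mul, hP, hQ, mul_zero, mul_zero, add_zero]

/-- If `D A = 0`, `D P = 0` and `D Q = P` then `D ^ d (A P^b Q^d) = d! A P^(b+d)`. -/
theorem dotUD_pow_apply {i j : Fin n} {A P Q : VPoly n m} (hA : dotUD i j A = 0)
    (hP : dotUD i j P = 0) (hQ : dotUD i j Q = P) (d : ℕ) :
    ∀ b, (dotUD i j ^ d) (A * (P ^ b * Q ^ d)) = d.factorial • (A * P ^ (b + d)) := by
  induction d with
  | zero => intro b; simp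
  | succ d ih =>
    intro b
    have : dotUD i j (A * (P ^ b * Q ^ (d + 1))) = (d + 1) • (A * (P ^ (b + 1) * Q ^ d)) := by
      rw [dotUD_mul, dotUD_mul, hA, dotUD_pow_eq_zero_of_eq_zero hP, dotUD_pow, hQ,
        Nat.add_sub_cancel]
      simp only [nsmul_eq_mul]
      ring
    rw [pow_succ, Module.End.mul_apply, this, map_nsmul, ih, ← mul_smul, ← Nat.factorial_succ,
      add_assoc, add_comm 1]

end minors

/-! ### A model of the irreducible module of highest weight `μ` -/

section model

variable {k : ℕ}

/-- The index set of the leading principal minor with rows `0, …, p`. -/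
abbrev LeadingIndex (p : Fin k) : Type := {a : Fin (k + 1) // a ≤ p.castSucc}

/-- The minor with rows and columns `0, …, p`. -/
noncomputable def leadingMinor (p : Fin k) : VPoly (k + 1) (k + 1) :=
  minor (fun a : LeadingIndex p => a.1) (fun a => a.1)

/-- The row labels `p + 1, 1, …, p`. -/
def shiftedRows (p : Fin k) (a : LeadingIndex p) : Fin (k + 1) :=
  if a.1 = 0 then p.succ else a.1

/-- The minor with rows `p + 1, 1, …, p` and columns `0, …, p`. -/
noncomputable def shiftedMinor (p : Fin k) : VPoly (k + 1) (k + 1) :=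
  minor (shiftedRows p) (fun a => a.1)

/-- The determinant of the matrix of variables. -/
noncomputable def fullMinor (k : ℕ) : VPoly (k + 1) (k + 1) :=
  minor (fun a : Fin (k + 1) => a) (fun a => a)

theorem shiftedRows_injective (p : Fin k) : (shiftedRows p).Injective := by
  rintro ⟨a, ha⟩ ⟨b, hb⟩ h
  have hp : ∀ c : Fin (k + 1), c ≤ p.castSucc → c ≠ p.succ := fun c hc h =>
    absurd hc (by rw [h]; exact not_le.2 Fin.castSucc_lt_succ)
  simp only [shiftedRows] at h
  simp only [Subtype.mk.injEq]
  split_ifs at h with h1 h2 h2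
  · rw [h1, h2]
  · exact absurd h.symm (hp b hb)
  · exact absurd h (hp a ha)
  · exact h

theorem exists_shiftedRows_eq {p : Fin k} {i : Fin (k + 1)} :
    (∃ a, shiftedRows p a = i) ↔ i ≠ 0 ∧ i ≤ p.succ := by
  constructor
  · rintro ⟨⟨a, ha⟩, rfl⟩
    simp only [shiftedRows]
    split_ifs with h
    · exact ⟨Fin.succ_ne_zero p, le_rfl⟩
    · exact ⟨h, ha.trans Fin.castSucc_lt_succ.le⟩
  · rintro ⟨h0, hi⟩
    rcases hi.eq_or_lt with rfl | hi
    · exact ⟨⟨0, Fin.zero_le _⟩, by simp [shiftedRows]⟩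
    · exact ⟨⟨i, Fin.le_castSucc_iff.2 hi⟩, by simp [shiftedRows, h0]⟩

theorem dotUD_leadingMinor {i j : Fin (k + 1)} (hij : i < j) (p : Fin k) :
    dotUD i j (leadingMinor p) = 0 := by
  refine dotUD_minor_eq_zero hij.ne ?_
  rintro ⟨⟨a, ha⟩, rfl⟩
  exact ⟨⟨i, hij.le.trans ha⟩, rfl⟩

theorem dotUD_fullMinor {i j : Fin (k + 1)} (hij : i < j) : dotUD i j (fullMinor k) = 0 :=
  dotUD_minor_eq_zero hij.ne fun _ => ⟨i, rfl⟩

theorem dotUD_shiftedMinor {i j : Fin k} (hij : i < j) (p : Fin k) :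
    dotUD i.succ j.succ (shiftedMinor p) = 0 := by
  refine dotUD_minor_eq_zero (by rw [Ne, Fin.succ_inj]; exact hij.ne) ?_
  rw [exists_shiftedRows_eq, exists_shiftedRows_eq]
  exact fun h => ⟨Fin.succ_ne_zero _, (Fin.succ_le_succ_iff.2 hij.le).trans h.2⟩

theorem dotUD_zero_shiftedMinor {p q : Fin k} (hpq : p < q) :
    dotUD 0 q.succ (shiftedMinor p) = 0 := by
  refine dotUD_minor_eq_zero (Fin.succ_ne_zero _).symm ?_
  rw [exists_shiftedRows_eq]
  exact fun h => absurd (Fin.succ_le_succ_iff.1 h.2) (not_le.2 hpq)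

theorem dotUD_zero_shiftedMinor_self (p : Fin k) :
    dotUD 0 p.succ (shiftedMinor p) = leadingMinor p := by
  rw [shiftedMinor, dotUD_minor_of_mem (shiftedRows_injective p) (a := ⟨0, Fin.zero_le _⟩)
    (by simp [shiftedRows]), leadingMinor]
  congr 1
  funext a
  by_cases ha : a = ⟨0, Fin.zero_le _⟩
  · rw [ha]; simp
  · rw [Function.update_of_ne ha, shiftedRows, if_neg fun h => ha (Subtype.ext h)]

theorem dotUD_self_leadingMinor (i : Fin (k + 1)) (p : Fin k) :
    dotUD i i (leadingMinor p) = (if i ≤ p.castSucc then (1 : ℂ) else 0) • leadingMinor p := by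
  classical
  rw [leadingMinor, dotUD_self_minor i Subtype.val_injective]
  simp

theorem dotUD_self_fullMinor (i : Fin (k + 1)) : dotUD i i (fullMinor k) = fullMinor k := by
  classical
  rw [fullMinor, dotUD_self_minor i (f := fun a : Fin (k + 1) => a) fun _ _ h => h]
  simp

/-- The product of powers of minors with exponents `μ_p - μ_{p+1}` in which, for `p < j`, the
leading minor `0, …, p` is replaced `d_p` times by the minor with rows `1, …, p + 1`. For `j = 0`
it is a highest weight vector of weight `μ`, for `j = k` a highest weight vector of `gl(k)`. -/
noncomputable def modelVector (μ : Fin (k + 1) → ℕ) (d : Fin k → ℕ) (j : ℕ) :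
    VPoly (k + 1) (k + 1) :=
  (∏ p : Fin k, if (p : ℕ) < j then
      leadingMinor p ^ (μ p.castSucc - μ p.succ - d p) * shiftedMinor p ^ d p
    else leadingMinor p ^ (μ p.castSucc - μ p.succ)) * fullMinor k ^ μ (Fin.last k)

theorem dotUD_prod_eq_zero {n m : ℕ} {ι : Type*} {i j : Fin n} (s : Finset ι)
    {F : ι → VPoly n m} (h : ∀ a ∈ s, dotUD i j (F a) = 0) : dotUD i j (∏ a ∈ s, F a) = 0 := by
  classical
  rw [dotUD_prod]
  exact Finset.sum_eq_zero fun a ha => by rw [h a ha, mul_zero]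

theorem modelVector_mem_subHighest (μ : Fin (k + 1) → ℕ) (d : Fin k → ℕ) (j : ℕ) :
    modelVector μ d j ∈ subHighest k (k + 1) := by
  refine mem_subHighest.2 fun a b hab => ?_
  have hab' := Fin.succ_lt_succ_iff.2 hab
  refine dotUD_mul_eq_zero (dotUD_prod_eq_zero _ fun p _ => ?_)
    (dotUD_pow_eq_zero_of_eq_zero (dotUD_fullMinor hab') _)
  split_ifs
  · exact dotUD_mul_eq_zero (dotUD_pow_eq_zero_of_eq_zero (dotUD_leadingMinor hab' p) _)
      (dotUD_pow_eq_zero_of_eq_zero (dotUD_shiftedMinor hab p) _)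
  · exact dotUD_pow_eq_zero_of_eq_zero (dotUD_leadingMinor hab' p) _

theorem sum_sub_succ (μ : Fin (k + 1) → ℕ) (i : Fin (k + 1)) :
    ∑ p : Fin k, (if i ≤ p.castSucc then ((μ p.castSucc : ℂ) - μ p.succ) else 0)
      + μ (Fin.last k) = μ i := by
  induction i using Fin.reverseInduction with
  | last => simp [Fin.last_le_iff, (Fin.castSucc_lt_last _).ne]
  | cast q ih =>
    have : ∀ p : Fin k, (if q.castSucc ≤ p.castSucc then ((μ p.castSucc : ℂ) - μ p.succ) else 0)
        = (if q.succ ≤ p.castSucc then ((μ p.castSucc : ℂ) - μ p.succ) else 0)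
          + if p = q then ((μ p.castSucc : ℂ) - μ p.succ) else 0 := by
      intro p
      rcases lt_trichotomy p q with h | rfl | h
      · have h1 : ¬ q.castSucc ≤ p.castSucc := by simpa using h
        have h2 : ¬ q.succ ≤ p.castSucc := by simpa using h.le
        simp [h1, h2, h.ne]
      · simp
      · have h2 : q.succ ≤ p.castSucc := by simpa using h
        simp [h.le, h2, h.ne']
    rw [Finset.sum_congr rfl fun p _ => this p, Finset.sum_add_distrib, add_right_comm, ih]
    simp

theorem modelVector_zero_isHighestWeight {μ : Fin (k + 1) → ℕ} (hμ : Antitone μ)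
    (d : Fin k → ℕ) : IsHighestWeight dotUD (fun i => (μ i : ℂ)) (modelVector μ d 0) := by
  classical
  have h0 : modelVector μ d 0 = (∏ p : Fin k, leadingMinor p ^ (μ p.castSucc - μ p.succ))
      * fullMinor k ^ μ (Fin.last k) := by simp [modelVector]
  rw [h0]
  constructor
  · intro a b hab
    exact dotUD_mul_eq_zero (dotUD_prod_eq_zero _ fun p _ =>
      dotUD_pow_eq_zero_of_eq_zero (dotUD_leadingMinor hab p) _)
      (dotUD_pow_eq_zero_of_eq_zero (dotUD_fullMinor hab) _)
  · intro i
    have h1 := dotUD_prod_of_eigen (i := i) Finset.univ fun p : Fin k =>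
      dotUD_pow_of_eigen (dotUD_self_leadingMinor i p) (μ p.castSucc - μ p.succ)
    have h2 := dotUD_pow_of_eigen (c := 1) (by rw [dotUD_self_fullMinor, one_smul])
      (i := i) (P := fullMinor k) (μ (Fin.last k))
    rw [dotUD_mul, h1, h2, mul_smul_comm, mul_smul_comm, mul_comm (fullMinor k ^ _), ← add_smul,
      ← sum_sub_succ μ i, mul_one, add_comm (μ (Fin.last k) : ℂ)]
    congr 2
    refine Finset.sum_congr rfl fun p _ => ?_
    rw [Nat.cast_sub (hμ Fin.castSucc_lt_succ.le), mul_ite, mul_one, mul_zero]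

theorem eval_minor_one {ι : Type*} [Fintype ι] [DecidableEq ι] {f : ι → Fin (k + 1)}
    (hf : f.Injective) :
    eval (fun p : Fin (k + 1) × Fin (k + 1) => if p.1 = p.2 then (1 : ℂ) else 0) (minor f f)
      = 1 := by
  rw [minor, RingHom.map_det]
  convert Matrix.det_one (n := ι) (R := ℂ)
  ext a b
  simp [Matrix.one_apply, hf.eq_iff]

theorem modelVector_zero_ne_zero (μ : Fin (k + 1) → ℕ) (d : Fin k → ℕ) :
    modelVector μ d 0 ≠ 0 := by
  intro h
  have h' := congrArg
    (eval (fun p : Fin (k + 1) × Fin (k + 1) => if p.1 = p.2 then (1 : ℂ) else 0)) h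
  simp only [modelVector, not_lt_zero, if_false, map_mul, map_prod, map_pow, leadingMinor,
    fullMinor, map_zero] at h'
  rw [eval_minor_one (f := fun a : Fin (k + 1) => a) fun _ _ h => h] at h'
  simp [eval_minor_one Subtype.val_injective] at h'

theorem dotUD_pow_modelVector {μ : Fin (k + 1) → ℕ} {d : Fin k → ℕ} (hd : Betweenness μ d)
    (j : Fin k) : (dotUD 0 j.succ ^ d j) (modelVector μ d (j + 1)) =
      (d j).factorial • modelVector μ d j := by
  set A := (∏ p ∈ Finset.univ.erase j, if (p : ℕ) < j then
      leadingMinor p ^ (μ p.castSucc - μ p.succ - d p) * shiftedMinor p ^ d p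
    else leadingMinor p ^ (μ p.castSucc - μ p.succ)) * fullMinor k ^ μ (Fin.last k) with hA
  have h1 : modelVector μ d (j + 1) = A * (leadingMinor j ^ (μ j.castSucc - μ j.succ - d j)
      * shiftedMinor j ^ d j) := by
    rw [modelVector, ← Finset.mul_prod_erase _ _ (Finset.mem_univ j), if_pos (by omega), hA,
      mul_assoc, mul_comm]
    congr 2
    refine Finset.prod_congr rfl fun p hp => ?_
    have : (p : ℕ) ≠ j := fun h => Finset.ne_of_mem_erase hp (Fin.ext h)
    have : (p : ℕ) < j + 1 ↔ (p : ℕ) < j := by omega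
    simp only [this]
  have h2 : modelVector μ d j
      = A * leadingMinor j ^ (μ j.castSucc - μ j.succ - d j + d j) := by
    rw [modelVector, ← Finset.mul_prod_erase _ _ (Finset.mem_univ j), if_neg (by omega), hA,
      mul_assoc, mul_comm]
    congr 2
    have := hd j
    omega
  have h3 := Fin.succ_pos j
  rw [h1, h2]
  refine dotUD_pow_apply ?_ (dotUD_leadingMinor h3 j) (dotUD_zero_shiftedMinor_self j) _ _
  refine dotUD_mul_eq_zero (dotUD_prod_eq_zero _ fun p _ => ?_)
    (dotUD_pow_eq_zero_of_eq_zero (dotUD_fullMinor h3) _)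
  split_ifs with hp
  · exact dotUD_mul_eq_zero (dotUD_pow_eq_zero_of_eq_zero (dotUD_leadingMinor h3 p) _)
      (dotUD_pow_eq_zero_of_eq_zero (dotUD_zero_shiftedMinor hp) _)
  · exact dotUD_pow_eq_zero_of_eq_zero (dotUD_leadingMinor h3 p) _

theorem fischer_dotUD_pow {n m : ℕ} (i j : Fin n) (t : ℕ) (Q P : VPoly n m) :
    fischer Q ((dotUD i j ^ t) P) = fischer ((dotUD j i ^ t) Q) P := by
  induction t generalizing P with
  | zero => rfl
  | succ t ih =>
    rw [pow_succ, Module.End.mul_apply, ih, fischer_dotUD, ← Module.End.mul_apply, ← pow_succ']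

/-- In the model, the vector `lowerPow d` applied to the highest weight vector does not lie in
the image of the lowering operators of `gl(k)`: it is not orthogonal to a highest weight vector
of `gl(k)`. -/
theorem lowerPow_modelVector_notMem {μ : Fin (k + 1) → ℕ} {d : Fin k → ℕ}
    (hd : Betweenness μ d) (N : Submodule ℂ (VPoly (k + 1) (k + 1))) :
    lowerPow dotUD d k (modelVector μ d 0) ∉ lowerPart dotUD N k := by
  intro hmem
  have key : ∀ j, j ≤ k →
      fischer (modelVector μ d j) (lowerPow dotUD d j (modelVector μ d 0)) ≠ 0 := by
    intro j
    induction j with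
    | zero =>
      intro _ h
      exact modelVector_zero_ne_zero μ d (eq_zero_of_fischer_self h)
    | succ j ih =>
      intro hj
      have h := ih (by omega)
      have h1 := dotUD_pow_modelVector hd ⟨j, hj⟩
      simp only at h1
      rw [lowerPow_succ_apply, dif_pos (by omega),
        fischer_dotUD_pow, h1, ← Nat.cast_smul_eq_nsmul ℂ]
      have hs : ∀ (c : ℕ) (Q P : VPoly (k + 1) (k + 1)), fischer ((c : ℂ) • Q) P
          = c * fischer Q P := by
        intro c Q P
        rw [fischer_eq_sum, fischer_eq_sum, Finset.mul_sum]
        refine Finset.sum_congr rfl fun α _ => ?_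
        rw [coeff_smul, smul_eq_mul, map_mul, Complex.conj_natCast]
        ring
      rw [hs]
      exact mul_ne_zero (by exact_mod_cast Nat.factorial_ne_zero _) h
  exact key k le_rfl (fischer_lowerPart (modelVector_mem_subHighest μ d k) hmem)

end model

/-! ### Comparison with the model -/

section transfer

variable {k m : ℕ}

theorem GlRelations.prodMap {n : ℕ} {V W : Type*} [AddCommGroup V] [Module ℂ V]
    [AddCommGroup W] [Module ℂ W] {e : Fin n → Fin n → Module.End ℂ V}
    {f : Fin n → Fin n → Module.End ℂ W} (he : GlRelations e) (hf : GlRelations f) :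
    GlRelations (fun i j => (e i j).prodMap (f i j)) := fun i j l r v => by
  refine Prod.ext ?_ ?_
  · have := he i j l r v.1
    simp only [LinearMap.prodMap_apply, Prod.fst_add, Prod.fst_sub, apply_ite Prod.fst,
      Prod.fst_zero, this]
  · have := hf i j l r v.2
    simp only [LinearMap.prodMap_apply, Prod.snd_add, Prod.snd_sub, apply_ite Prod.snd,
      Prod.snd_zero, this]

theorem lowerPow_prodMap {V W : Type*} [AddCommGroup V] [Module ℂ V]
    [AddCommGroup W] [Module ℂ W] (e : Fin (k + 1) → Fin (k + 1) → Module.End ℂ V)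
    (f : Fin (k + 1) → Fin (k + 1) → Module.End ℂ W) (d : Fin k → ℕ) (j : ℕ) (v : V) (w : W) :
    lowerPow (fun i j => (e i j).prodMap (f i j)) d j (v, w) =
      (lowerPow e d j v, lowerPow f d j w) := by
  have hpow : ∀ (q : Fin k) (t : ℕ) (x : V × W), (((e q.succ 0).prodMap (f q.succ 0)) ^ t) x =
      ((e q.succ 0 ^ t) x.1, (f q.succ 0 ^ t) x.2) := by
    intro q t
    induction t with
    | zero => intro x; rfl
    | succ t ih => intro x; rw [pow_succ, pow_succ, pow_succ, Module.End.mul_apply, ih]; rfl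
  induction j with
  | zero => rfl
  | succ j ih =>
    rw [lowerPow_succ_apply, lowerPow_succ_apply, lowerPow_succ_apply, ih]
    split_ifs
    · rw [hpow]
    · rfl

theorem fischer_negativePart {n : ℕ} {V : Type*} [AddCommGroup V] [Module ℂ V] {Q : VPoly n m}
    (hQ : ∀ i j, i < j → dotUD i j Q = 0) {e : Fin n → Fin n → Module.End ℂ V}
    {f : V →ₗ[ℂ] VPoly n m} (hf : ∀ i j y, f (e i j y) = dotUD i j (f y))
    {N : Submodule ℂ V} {z : V} (hz : z ∈ negativePart e N) : fischer Q (f z) = 0 := by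
  have : negativePart e N ≤ LinearMap.ker (fischer Q ∘ₗ f) := by
    refine Submodule.span_le.2 ?_
    rintro _ ⟨i, j, hij, y, _, rfl⟩
    change fischer Q (f (e i j y)) = 0
    rw [hf]
    exact fischer_dotUD_eq_zero (hQ j i hij) _
  exact this hz

/-- If `h` and `h'` are highest weight vectors of the same weight (in two polynomial modules), then
the module generated by `(h, h')` is the graph of a map on the first component. -/
theorem eq_zero_of_mem_loweringSpan_prod {m' : ℕ} {ν : Fin (k + 1) → ℂ} {h : VPoly (k + 1) m}
    {h' : VPoly (k + 1) m'} (hh : IsHighestWeight dotUD ν h) (hh' : IsHighestWeight dotUD ν h')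
    (h0 : h ≠ 0) {y : VPoly (k + 1) m'}
    (hy : ((0 : VPoly (k + 1) m), y) ∈ loweringSpan
      (fun i j => (dotUD (m := m) i j).prodMap (dotUD (m := m') i j)) (Submodule.span ℂ {(h, h')})) :
    y = 0 := by
  set e := fun i j : Fin (k + 1) => (dotUD (m := m) i j).prodMap (dotUD (m := m') i j)
  have he : GlRelations e := glRelations_dotUD.prodMap glRelations_dotUD
  set H : Submodule ℂ (VPoly (k + 1) m × VPoly (k + 1) m') := Submodule.span ℂ {(h, h')}
  have hH : ∀ x ∈ H, IsHighestWeight e ν x := by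
    intro x hx
    obtain ⟨c, rfl⟩ := Submodule.mem_span_singleton.1 hx
    refine ⟨fun i j hij => ?_, fun i => ?_⟩
    · simp [e, hh.raise i j hij, hh'.raise i j hij]
    · simp [e, hh.weight, hh'.weight, smul_comm c]
  have hfst : ∀ i j x, LinearMap.fst ℂ (VPoly (k + 1) m) (VPoly (k + 1) m') (e i j x) =
    dotUD i j (LinearMap.fst ℂ _ _ x) := fun _ _ _ => rfl
  have hsnd : ∀ i j x, LinearMap.snd ℂ (VPoly (k + 1) m) (VPoly (k + 1) m') (e i j x) =
    dotUD i j (LinearMap.snd ℂ _ _ x) := fun _ _ _ => rfl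
  -- the vectors `(0, y)` of the module have no component along `h'`
  have horth : ∀ y : VPoly (k + 1) m', ((0 : VPoly (k + 1) m), y) ∈ loweringSpan e H →
      fischer y h' = 0 := by
    intro y hy
    obtain ⟨x, hx, z, hz, hxz⟩ := Submodule.mem_sup.1 (loweringSpan_le_sup_negativePart hy)
    obtain ⟨c, rfl⟩ := Submodule.mem_span_singleton.1 hx
    have h1 : fischer h (LinearMap.fst ℂ _ _ z) = 0 :=
      fischer_negativePart hh.raise hfst hz
    have h2 : fischer h' (LinearMap.snd ℂ _ _ z) = 0 :=
      fischer_negativePart hh'.raise hsnd hz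
    rw [LinearMap.fst_apply] at h1
    rw [LinearMap.snd_apply] at h2
    have h3 : c • h + z.1 = 0 := congrArg Prod.fst hxz
    have h4 : c • h' + z.2 = y := congrArg Prod.snd hxz
    have h5 := congrArg (fischer h) h3
    rw [map_add, map_smul, h1, add_zero, map_zero, smul_eq_mul] at h5
    have hc : c = 0 := (mul_eq_zero.1 h5).resolve_right fun h => h0 (eq_zero_of_fischer_self h)
    rw [hc, zero_smul, zero_add] at h4
    rw [← h4]
    exact fischer_eq_zero_symm h2
  have hstep : ∀ (i j : Fin (k + 1)) (w : VPoly (k + 1) m × VPoly (k + 1) m'),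
      (∀ y, ((0 : VPoly (k + 1) m), y) ∈ loweringSpan e H → fischer y w.2 = 0) →
      ∀ y, ((0 : VPoly (k + 1) m), y) ∈ loweringSpan e H → fischer y (e i j w).2 = 0 := by
    intro i j w hw y hy
    change fischer y (dotUD i j w.2) = 0
    rw [fischer_dotUD]
    refine hw _ ?_
    have := apply_mem_loweringSpan he hH j i hy
    simpa [e] using this
  have hall : ∀ w, LoweringWord e H w →
      ∀ y, ((0 : VPoly (k + 1) m), y) ∈ loweringSpan e H → fischer y w.2 = 0 := by
    intro w hw
    induction hw with
    | ofAbelian w hw =>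
      induction hw with
      | base x hx =>
        obtain ⟨c, rfl⟩ := Submodule.mem_span_singleton.1 hx
        intro y hy
        change fischer y (c • h') = 0
        rw [map_smul, horth y hy, smul_zero]
      | step q w _ ih => exact hstep _ _ w ih
    | step i j _ w _ ih => exact hstep _ _ w ih
  refine eq_zero_of_fischer_self ?_
  have : loweringSpan e H ≤ LinearMap.ker (fischer y ∘ₗ LinearMap.snd ℂ _ _) :=
    Submodule.span_le.2 fun w hw => LinearMap.mem_ker.2 (by
      rw [LinearMap.comp_apply, LinearMap.snd_apply]; exact hall w hw y hy)
  have h1 := LinearMap.mem_ker.1 (this hy)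
  rwa [LinearMap.comp_apply, LinearMap.snd_apply] at h1

theorem exists_mem_loweringSpan_prod {V W : Type*} [AddCommGroup V] [Module ℂ V]
    [AddCommGroup W] [Module ℂ W] {e : Fin (k + 1) → Fin (k + 1) → Module.End ℂ V}
    {f : Fin (k + 1) → Fin (k + 1) → Module.End ℂ W}
    (he : GlRelations fun i j => (e i j).prodMap (f i j)) {h : V} {h' : W} {v : V}
    (hv : v ∈ loweringSpan e (Submodule.span ℂ {h})) :
    ∃ w, (v, w) ∈ loweringSpan (fun i j => (e i j).prodMap (f i j))
      (Submodule.span ℂ {(h, h')}) := by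
  set T := loweringSpan (fun i j => (e i j).prodMap (f i j)) (Submodule.span ℂ {(h, h')})
  have key : loweringSpan e (Submodule.span ℂ {h}) ≤ T.map (LinearMap.fst ℂ V W) := by
    refine Submodule.span_le.2 fun v hv => ?_
    induction hv with
    | ofAbelian v hv =>
      induction hv with
      | base v hv =>
        obtain ⟨c, rfl⟩ := Submodule.mem_span_singleton.1 hv
        exact ⟨c • (h, h'), mem_loweringSpan_of_mem
          (Submodule.smul_mem _ _ (Submodule.mem_span_singleton_self _)), rfl⟩
      | step q v _ ih =>
        obtain ⟨x, hx, rfl⟩ := ih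
        exact ⟨_, lower_zero_mem_loweringSpan he q hx, rfl⟩
    | step i j hij v _ ih =>
      obtain ⟨x, hx, rfl⟩ := ih
      exact ⟨_, lower_mem_loweringSpan hij hx, rfl⟩
  obtain ⟨x, hx, rfl⟩ := key hv
  exact ⟨x.2, hx⟩

/-- If the betweenness conditions hold, then `lowerPow d h` does not lie in the image of the
lowering operators of `gl(k)` on the module generated by the highest weight vector `h`. -/
theorem lowerPow_notMem_lowerPart {μ : Fin (k + 1) → ℕ} (hμ : Antitone μ) {d : Fin k → ℕ}
    (hd : Betweenness μ d) {h : VPoly (k + 1) m}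
    (hh : IsHighestWeight dotUD (fun i => (μ i : ℂ)) h) (h0 : h ≠ 0) :
    lowerPow dotUD d k h ∉ lowerPart dotUD (loweringSpan dotUD (Submodule.span ℂ {h})) k := by
  intro hmem
  set h' := modelVector μ d 0
  have hh' := modelVector_zero_isHighestWeight hμ d
  set e := fun i j : Fin (k + 1) => (dotUD (m := m) i j).prodMap (dotUD (m := k + 1) i j) with e_def
  have he : GlRelations e := glRelations_dotUD.prodMap glRelations_dotUD
  set H : Submodule ℂ (VPoly (k + 1) m × VPoly (k + 1) (k + 1)) := Submodule.span ℂ {(h, h')}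
  have hH : ∀ x ∈ H, IsHighestWeight e (fun i => (μ i : ℂ)) x := by
    intro x hx
    obtain ⟨c, rfl⟩ := Submodule.mem_span_singleton.1 hx
    refine ⟨fun i j hij => ?_, fun i => ?_⟩
    · simp [e, hh.raise i j hij, h', hh'.raise i j hij]
    · simp [e, hh.weight, h', hh'.weight, smul_comm c]
  have hlift : lowerPart dotUD (loweringSpan dotUD (Submodule.span ℂ {h})) k ≤
      (loweringSpan e H ⊓ (lowerPart dotUD ⊤ k).comap (LinearMap.snd ℂ _ _)).map
        (LinearMap.fst ℂ _ _) := by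
    refine Submodule.span_le.2 ?_
    rintro _ ⟨q, i, hiq, hq, y, hy, rfl⟩
    obtain ⟨w, hw⟩ := exists_mem_loweringSpan_prod he (h' := h') hy
    exact ⟨_, ⟨apply_mem_loweringSpan he hH q.succ i.succ hw,
      mem_lowerPart hiq hq Submodule.mem_top⟩, rfl⟩
  obtain ⟨⟨x, y⟩, ⟨hxy, hy⟩, hx⟩ := hlift hmem
  have hx' : x = lowerPow dotUD d k h := hx
  have h1 : (lowerPow dotUD d k h, lowerPow dotUD d k h') ∈ loweringSpan e H := by
    rw [← lowerPow_prodMap]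
    exact lowerPow_apply_mem (fun i j y hy => apply_mem_loweringSpan he hH i j hy) d k
      (mem_loweringSpan_of_mem (Submodule.mem_span_singleton_self _))
  have h2 := sub_mem h1 hxy
  rw [Prod.mk_sub_mk, hx', sub_self] at h2
  have h3 := eq_zero_of_mem_loweringSpan_prod hh hh' h0 h2
  rw [sub_eq_zero] at h3
  refine lowerPow_modelVector_notMem hd ⊤ ?_
  change lowerPow dotUD d k h' ∈ _
  rw [h3]
  exact hy

end transfer

/-! ### The action of `U(gl(n))` -/

section enveloping

variable {n m : ℕ}

theorem unitE_commutator (i j l r : Fin n) :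
    unitE i j * unitE l r - unitE l r * unitE i j =
      (if j = l then unitE i r else 0) - (if r = i then unitE l j else 0) := by
  have h := (UniversalEnvelopingAlgebra.ι ℂ).map_lie (Matrix.single i j (1 : ℂ))
    (Matrix.single l r (1 : ℂ))
  rw [LieRing.of_associative_ring_bracket, LieRing.of_associative_ring_bracket] at h
  rw [unitE, unitE, ← h, map_sub]
  congr 1
  · split_ifs with h
    · subst h; simp [unitE]
    · simp [h]
  · split_ifs with h
    · subst h; simp [unitE]
    · simp [h]

/-- A subalgebra that contains the operators of the matrix units contains the image of
`U(gl(n))`. -/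
theorem act_mem_subalgebra {S : Subalgebra ℂ (Module.End ℂ (VPoly n m))}
    (hS : ∀ i j, opE i j ∈ S) (a : UGl n) : act n m a ∈ S := by
  have hmem : ∀ A, glRep n m A ∈ S := fun A => by
    change ∑ i : Fin n, ∑ j : Fin n, A i j • opE i j ∈ S
    exact sum_mem fun i _ => sum_mem fun j _ => S.smul_mem (hS i j) _
  let f : Matrix (Fin n) (Fin n) ℂ →ₗ⁅ℂ⁆ S :=
    { toFun := fun A => ⟨glRep n m A, hmem A⟩
      map_add' := fun A B => Subtype.ext (map_add _ A B)
      map_smul' := fun c A => Subtype.ext (map_smul (glRep n m) c A)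
      map_lie' := fun {A B} => Subtype.ext ((glRep n m).map_lie A B) }
  have h : act n m = S.val.comp (UniversalEnvelopingAlgebra.lift ℂ f) := by
    refine UniversalEnvelopingAlgebra.hom_ext ℂ (LieHom.ext fun A => ?_)
    change UniversalEnvelopingAlgebra.lift ℂ (glRep n m) (UniversalEnvelopingAlgebra.ι ℂ A) =
      S.val (UniversalEnvelopingAlgebra.lift ℂ f (UniversalEnvelopingAlgebra.ι ℂ A))
    rw [UniversalEnvelopingAlgebra.lift_ι_apply, UniversalEnvelopingAlgebra.lift_ι_apply]
    rfl
  rw [h]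
  exact (UniversalEnvelopingAlgebra.lift ℂ f a).2

theorem act_apply_mem {N : Submodule ℂ (VPoly n m)}
    (hN : ∀ i j, ∀ P ∈ N, dotUD i j P ∈ N) (a : UGl n) {P : VPoly n m} (hP : P ∈ N) :
    act n m a P ∈ N := by
  let S : Subalgebra ℂ (Module.End ℂ (VPoly n m)) :=
    { carrier := {f | ∀ P ∈ N, f P ∈ N}
      mul_mem' := fun hf hg P hP => hf _ (hg P hP)
      add_mem' := fun hf hg P hP => add_mem (hf P hP) (hg P hP)
      algebraMap_mem' := fun c P hP => by
        rw [Module.algebraMap_end_apply]; exact N.smul_mem c hP }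
  exact act_mem_subalgebra (S := S) (fun i j P hP => opE_apply_mem hN i j hP) a P hP

theorem rotate_dotUD (g : Matrix (Fin m) (Fin m) ℝ) (i j : Fin n) (P : VPoly n m) :
    rotate n g (dotUD i j P) = dotUD i j (rotate n g P) := by
  induction P using MvPolynomial.induction_on with
  | C c => rw [dotUD_C, map_zero, algHom_C, algebraMap_eq, dotUD_C]
  | add P Q hP hQ => simp only [map_add, hP, hQ]
  | mul_X P p hP =>
    rw [dotUD_mul, map_add, map_mul, map_mul, map_mul, dotUD_mul, hP, dotUD_X]
    congr 2
    simp only [rotate, aeval_X, map_sum, dotUD_mul, dotUD_C, dotUD_X, mul_zero, add_zero]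
    split_ifs with h <;> simp

theorem act_rotate (g : Matrix (Fin m) (Fin m) ℝ) (a : UGl n) (P : VPoly n m) :
    act n m a (rotate n g P) = rotate n g (act n m a P) := by
  have hmem : act n m a ∈ Subalgebra.centralizer ℂ {(rotate n g).toLinearMap} := by
    refine act_mem_subalgebra (fun i j => ?_) a
    rw [Subalgebra.mem_centralizer_iff]
    rintro _ rfl
    refine LinearMap.ext fun Q => ?_
    by_cases hij : i = j
    · subst hij; simp [opE_self_apply, rotate_dotUD]
    · simp [opE_of_ne hij, rotate_dotUD]
  exact (LinearMap.congr_fun (Subalgebra.mem_centralizer_iff ℂ |>.1 hmem _ rfl) P).symm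

/-- `a ∈ U(gl(n))` has weight `ν` for the adjoint action of the `E_{pp}`. -/
def HasWeight (a : UGl n) (ν : Fin n → ℂ) : Prop :=
  ∀ p, unitE p p * a - a * unitE p p = ν p • a

theorem HasWeight.mul {a b : UGl n} {ν ξ : Fin n → ℂ} (ha : HasWeight a ν)
    (hb : HasWeight b ξ) : HasWeight (a * b) (ν + ξ) := fun p => by
  have : unitE p p * (a * b) - a * b * unitE p p =
      (unitE p p * a - a * unitE p p) * b + a * (unitE p p * b - b * unitE p p) := by
    noncomm_ring
  rw [this, ha p, hb p, smul_mul_assoc, mul_smul_comm, ← add_smul, Pi.add_apply]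

theorem HasWeight.add {a b : UGl n} {ν : Fin n → ℂ} (ha : HasWeight a ν)
    (hb : HasWeight b ν) : HasWeight (a + b) ν := fun p => by
  rw [mul_add, add_mul, add_sub_add_comm, ha p, hb p, smul_add]

theorem HasWeight.sub {a b : UGl n} {ν : Fin n → ℂ} (ha : HasWeight a ν)
    (hb : HasWeight b ν) : HasWeight (a - b) ν := fun p => by
  rw [mul_sub, sub_mul, sub_sub_sub_comm, ha p, hb p, smul_sub]

theorem hasWeight_one : HasWeight (1 : UGl n) 0 := fun p => by simp

theorem hasWeight_algebraMap (c : ℂ) : HasWeight (algebraMap ℂ (UGl n) c) 0 := fun p => by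
  rw [Algebra.commutes, sub_self, Pi.zero_apply, zero_smul]

theorem HasWeight.pow {a : UGl n} {ν : Fin n → ℂ} (ha : HasWeight a ν) (t : ℕ) :
    HasWeight (a ^ t) ((t : ℂ) • ν) := by
  induction t with
  | zero => simpa using hasWeight_one
  | succ t ih =>
    rw [pow_succ]
    convert ih.mul ha using 1
    push_cast
    module

theorem hasWeight_unitE (i j : Fin n) :
    HasWeight (unitE i j) (Pi.single i 1 - Pi.single j 1) := fun p => by
  rw [unitE_commutator, Pi.sub_apply, sub_smul, Pi.single_apply, Pi.single_apply, ite_smul,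
    ite_smul, one_smul, zero_smul]
  congr 1
  · split_ifs with h
    · rw [h]
    · rfl
  · rcases eq_or_ne j p with h | h
    · rw [if_pos h, if_pos h.symm, h]
    · rw [if_neg h, if_neg h.symm]

theorem hasWeight_unitE_self (i : Fin n) : HasWeight (unitE i i) 0 := by
  simpa using hasWeight_unitE i i

theorem HasWeight.dotUD_act {a : UGl n} {ν ξ : Fin n → ℂ} (ha : HasWeight a ν) {P : VPoly n m}
    (hP : ∀ i, dotUD i i P = ξ i • P) (i : Fin n) :
    dotUD i i (act n m a P) = (ξ i + ν i) • act n m a P := by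
  have h := congrArg (fun b => act n m b P) (ha i)
  simp only [map_sub, map_mul, act_unitE, map_smul, LinearMap.sub_apply, Module.End.mul_apply,
    LinearMap.smul_apply, opE_self_apply, hP, map_add] at h
  rw [add_smul]
  linear_combination (exp := 1) h

end enveloping

/-! ### Lowering operators -/

section lowering

variable {k m : ℕ}

/-- The element `E_{pp} - E_{jj} + j - p`; on a vector of weight `ℓ` it acts by
`(ℓ_p - p) - (ℓ_j - j)`. -/
noncomputable def weightGap (p j : Fin k) : UGl (k + 1) :=
  unitE p.succ p.succ - unitE j.succ j.succ + algebraMap ℂ _ ((j : ℂ) - (p : ℂ))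

/-- Partial sums of the lowering operators: with `c_j = weightGap p j`, they are given by
`K_0(i) = E_{i0}` and `K_{j+1}(i) = K_j(i) c_j + E_{ij} K_j(j)`. -/
noncomputable def lowerAux (p : Fin k) : ℕ → Fin k → UGl (k + 1)
  | 0, i => unitE i.succ 0
  | j + 1, i =>
    if hj : j < k then
      lowerAux p j i * weightGap p ⟨j, hj⟩ +
        unitE i.succ (Fin.succ ⟨j, hj⟩) * lowerAux p j ⟨j, hj⟩
    else lowerAux p j i

/-- The lowering operator `K_p(p) = E_{p0} ∏_{j < p} c_j + ⋯`. It maps highest weight vectors of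
`gl(k)` to highest weight vectors of `gl(k)` and raises the degree in `u_p` by one. -/
noncomputable def lowerOp (p : Fin k) : UGl (k + 1) := lowerAux p p p

/-- The ordered product of the powers `lowerOp p ^ d p` with `p < j`. For `j = k` this is the
embedding factor. -/
noncomputable def embeddingFactor (d : Fin k → ℕ) (j : ℕ) : UGl (k + 1) :=
  orderedProd (fun p => lowerOp p ^ d p) j

theorem hasWeight_weightGap (p j : Fin k) : HasWeight (weightGap p j) 0 :=
  ((hasWeight_unitE_self _).sub (hasWeight_unitE_self _)).add (hasWeight_algebraMap _)

theorem hasWeight_lowerAux (p : Fin k) (j : ℕ) (i : Fin k) :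
    HasWeight (lowerAux p j i) (Pi.single i.succ 1 - Pi.single 0 1) := by
  induction j generalizing i with
  | zero => exact hasWeight_unitE _ _
  | succ j ih =>
    rw [lowerAux]
    split_ifs with hj
    · refine HasWeight.add ?_ ?_
      · simpa using (ih i).mul (hasWeight_weightGap p ⟨j, hj⟩)
      · simpa using (hasWeight_unitE i.succ (Fin.succ ⟨j, hj⟩)).mul (ih ⟨j, hj⟩)
    · exact ih i

/-- The weight of `embeddingFactor d j`. -/
noncomputable def embeddingWeight (d : Fin k → ℕ) (j : ℕ) : Fin (k + 1) → ℂ :=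
  ∑ p : Fin k, (if (p : ℕ) < j then (d p : ℂ) else 0) • (Pi.single p.succ 1 - Pi.single 0 1)

theorem embeddingWeight_succ (d : Fin k → ℕ) (p : Fin k) :
    embeddingWeight d (p + 1) =
      (d p : ℂ) • (Pi.single p.succ 1 - Pi.single 0 1) + embeddingWeight d p := by
  have : ∀ q : Fin k, (if (q : ℕ) < p + 1 then (d q : ℂ) else 0)
      = (if q = p then (d q : ℂ) else 0) + if (q : ℕ) < p then (d q : ℂ) else 0 := by
    intro q
    by_cases h : q = p
    · subst h; simp
    · have h' : (q : ℕ) ≠ p := fun h' => h (Fin.ext h')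
      have : (q : ℕ) < p + 1 ↔ (q : ℕ) < p := by omega
      simp [h, this]
  simp only [embeddingWeight, this, add_smul, Finset.sum_add_distrib, ite_smul, zero_smul,
    Finset.sum_ite_eq', Finset.mem_univ, if_true]

theorem embeddingWeight_apply_succ (d : Fin k → ℕ) (j : ℕ) (q : Fin k) :
    embeddingWeight d j q.succ = if (q : ℕ) < j then (d q : ℂ) else 0 := by
  simp only [embeddingWeight, Finset.sum_apply, Pi.smul_apply, Pi.sub_apply, Pi.single_apply,
    Fin.succ_inj, Fin.succ_ne_zero, if_false, sub_zero, smul_eq_mul, mul_ite, mul_one, mul_zero,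
    Finset.sum_ite_eq, Finset.mem_univ, if_true]

theorem embeddingWeight_apply_zero (d : Fin k → ℕ) :
    embeddingWeight d k 0 = -∑ p, (d p : ℂ) := by
  simp [embeddingWeight, Finset.sum_apply, (Fin.succ_ne_zero _).symm]

theorem hasWeight_embeddingFactor (d : Fin k → ℕ) (j : ℕ) (hj : j ≤ k) :
    HasWeight (embeddingFactor d j) (embeddingWeight d j) := by
  induction j with
  | zero => simpa [embeddingFactor, orderedProd, embeddingWeight] using hasWeight_one
  | succ j ih =>
    have := embeddingWeight_succ d ⟨j, hj⟩
    simp only at this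
    rw [embeddingFactor, orderedProd, ← embeddingFactor, dif_pos (by omega), this]
    exact ((hasWeight_lowerAux _ _ _).pow _).mul (ih (by omega))

theorem isHomogeneousFactor_embeddingFactor (d : Fin k → ℕ) :
    IsHomogeneousFactor d (embeddingFactor d k) := fun p => by
  rw [hasWeight_embeddingFactor d k le_rfl, embeddingWeight_apply_succ, if_pos p.2]

theorem act_weightGap {ℓ : Fin (k + 1) → ℂ} {v : VPoly (k + 1) m}
    (hv : ∀ i, dotUD i i v = ℓ i • v) (p j : Fin k) :
    act (k + 1) m (weightGap p j) v = (ℓ p.succ - ℓ j.succ + j - p) • v := by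
  rw [weightGap, map_add, map_sub, act_unitE, act_unitE, AlgHom.commutes, LinearMap.add_apply,
    LinearMap.sub_apply, opE_self_apply, opE_self_apply, hv, hv, Module.algebraMap_end_apply]
  module

theorem act_lowerAux_zero (p i : Fin k) (v : VPoly (k + 1) m) :
    act (k + 1) m (lowerAux p 0 i) v = opE i.succ 0 v := by
  rw [lowerAux, act_unitE]

theorem act_lowerAux_succ {ℓ : Fin (k + 1) → ℂ} {v : VPoly (k + 1) m}
    (hv : ∀ i, dotUD i i v = ℓ i • v) (p i j : Fin k) :
    act (k + 1) m (lowerAux p (j + 1) i) v =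
      (ℓ p.succ - ℓ j.succ + j - p) • act (k + 1) m (lowerAux p j i) v +
        opE i.succ j.succ (act (k + 1) m (lowerAux p j j) v) := by
  rw [lowerAux, dif_pos j.2, map_add, LinearMap.add_apply, map_mul, map_mul,
    Module.End.mul_apply, Module.End.mul_apply, act_weightGap hv, act_unitE, map_smul]

theorem glRelations_opE {n m : ℕ} : GlRelations (opE (n := n) (m := m)) := fun i j l r P => by
  have h := LinearMap.congr_fun (opE_comm (m := m) i j l r) P
  have e : ∀ (c : Prop) [Decidable c] (f : Module.End ℂ (VPoly n m)),
      (if c then f else 0) P = if c then f P else 0 := by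
    intro c _ f; split_ifs <;> rfl
  rw [LinearMap.sub_apply, LinearMap.sub_apply, e, e] at h
  exact sub_eq_iff_eq_add'.1 h

/-- The raising operator `e a b` with `b = a + 1` annihilates the vector `G p p` if `G j i` is
given by the recursion of the lowering operators. The constants `c_j` are chosen such that the two
contributions of `j = a` and `j = b` to `e a b (G p p)` cancel, and such that `c_p = 0`. -/
theorem raise_lowerAux {W : Type*} [AddCommGroup W] [Module ℂ W]
    {e : Fin (k + 1) → Fin (k + 1) → Module.End ℂ W} (he : GlRelations e) {v : W}
    {G : ℕ → Fin k → W} {ℓ : Fin (k + 1) → ℂ} {p : Fin k}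
    (hG0 : ∀ i, G 0 i = e i.succ 0 v)
    (hG : ∀ j i : Fin k, G (j + 1) i =
      (ℓ p.succ - ℓ j.succ + j - p) • G j i + e i.succ j.succ (G j j))
    (hw : ∀ (j : ℕ) (i : Fin k) (b : Fin k), e b.succ b.succ (G j i) =
      (ℓ b.succ + if b = i then 1 else 0) • G j i)
    {a b : Fin k} (hab : (b : ℕ) = a + 1) (hv : e a.succ b.succ v = 0) :
    e a.succ b.succ (G p p) = 0 := by
  have hba : b ≠ a := fun h => by rw [h] at hab; omega
  have hcomm : ∀ (i j : Fin k) (x : W), e a.succ b.succ (e i.succ j.succ x) =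
      e i.succ j.succ (e a.succ b.succ x) +
        ((if b = i then e a.succ j.succ x else 0) - (if j = a then e i.succ b.succ x else 0)) := by
    intro i j x
    rw [he]
    simp only [Fin.succ_inj]
  have h1 : ∀ j : ℕ, j ≤ a → ∀ i : Fin k, e a.succ b.succ (G j i) = if i = b then G j a else 0 := by
    intro j
    induction j with
    | zero =>
      intro _ i
      rw [hG0, he, hv, map_zero, zero_add, if_neg (Fin.succ_ne_zero a).symm, sub_zero, hG0]
      simp only [Fin.succ_inj, eq_comm]
    | succ j ih =>
      intro hj i
      have hjk : j < k := by omega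
      have hGj := hG ⟨j, hjk⟩
      simp only at hGj
      have hjb : (⟨j, hjk⟩ : Fin k) ≠ b := fun h => by rw [← h] at hab; simp at hab; omega
      have hja : (⟨j, hjk⟩ : Fin k) ≠ a := fun h => by rw [← h] at hj; simp at hj
      rw [hGj i, map_add, map_smul, ih (by omega), hcomm, ih (by omega), if_neg hjb, if_neg hja,
        map_zero, zero_add, sub_zero]
      by_cases hi : i = b
      · rw [if_pos hi, if_pos hi.symm, if_pos hi, hGj a]
      · rw [if_neg hi, if_neg (Ne.symm hi), if_neg hi, smul_zero, zero_add]
  have h2 : ∀ i ≠ b, e a.succ b.succ (G (a + 1) i) = -e i.succ b.succ (G a a) := by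
    intro i hi
    rw [hG a i, map_add, map_smul, h1 a le_rfl, if_neg hi, hcomm, h1 a le_rfl, if_neg hba.symm,
      if_neg hi.symm, if_pos rfl, map_zero, smul_zero, zero_add, zero_add, zero_sub]
  have h2' : e a.succ b.succ (G b b) = (ℓ p.succ - ℓ b.succ + b - p) • G a a := by
    rw [hab, hG a b, map_add, map_smul, h1 a le_rfl, if_pos rfl, hcomm, h1 a le_rfl,
      if_neg hba.symm, if_pos rfl, if_pos rfl, map_zero, hw, hw, if_pos rfl, if_neg hba]
    push_cast
    module
  have h3 : ∀ j : ℕ, (b : ℕ) < j → j ≤ k → ∀ i ≠ b, e a.succ b.succ (G j i) = 0 := by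
    intro j
    induction j with
    | zero => intro h; omega
    | succ j ih =>
      intro hj hjk i hi
      rcases (Nat.lt_succ_iff.1 hj).eq_or_lt with rfl | hj'
      · rw [hG b i, map_add, map_smul, hcomm, h2', if_neg hi.symm, if_neg hba, hab, h2 i hi,
          map_smul]
        simp
      · have hGj := hG ⟨j, hjk⟩
        simp only at hGj
        have hjb : (⟨j, hjk⟩ : Fin k) ≠ b := fun h => by rw [← h] at hj'; simp at hj'
        have hja : (⟨j, hjk⟩ : Fin k) ≠ a := fun h => by rw [← h] at hab; simp at hab; omega
        rw [hGj i, map_add, map_smul, hcomm, ih hj' (by omega) i hi,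
          ih hj' (by omega) _ hjb, if_neg hi.symm, if_neg hja]
        simp
  rcases lt_trichotomy p b with h | rfl | h
  · rw [h1 p (by rw [Fin.lt_def] at h; omega), if_neg h.ne]
  · rw [h2', sub_self, zero_add, sub_self, zero_smul]
  · exact h3 p h p.2.le p h.ne'

theorem mem_subHighest_of_adjacent {P : VPoly (k + 1) m}
    (h : ∀ a b : Fin k, (b : ℕ) = a + 1 → dotUD a.succ b.succ P = 0) : P ∈ subHighest k m := by
  have key : ∀ t : ℕ, ∀ a b : Fin k, (b : ℕ) = a + t + 1 → dotUD a.succ b.succ P = 0 := by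
    intro t
    induction t with
    | zero => exact fun a b hab => h a b hab
    | succ t ih =>
      intro a b hab
      let c : Fin k := ⟨a + t + 1, by omega⟩
      have h1 := glRelations_dotUD a.succ c.succ c.succ b.succ P
      have hba : b.succ ≠ a.succ := fun h => by
        rw [Fin.succ_inj] at h; rw [h] at hab; omega
      rw [h c b (by simp [c]; omega), ih a c rfl, map_zero, map_zero, if_pos rfl, if_neg hba,
        zero_add, sub_zero] at h1
      exact h1.symm
  refine mem_subHighest.2 fun a b hab => key (b - a - 1) a b ?_
  rw [Fin.lt_def] at hab
  omega

theorem act_lowerOp_mem_subHighest {ℓ : Fin (k + 1) → ℂ} {v : VPoly (k + 1) m}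
    (hv : ∀ i, dotUD i i v = ℓ i • v) (hv' : v ∈ subHighest k m) (p : Fin k) :
    act (k + 1) m (lowerOp p) v ∈ subHighest k m := by
  refine mem_subHighest_of_adjacent fun a b hab => ?_
  have hlt : a < b := by rw [Fin.lt_def]; omega
  have hne : a.succ ≠ b.succ := by rw [Ne, Fin.succ_inj]; exact hlt.ne
  rw [← opE_of_ne hne]
  refine raise_lowerAux (ℓ := fun i => ℓ i + (m : ℂ) / 2) glRelations_opE (v := v)
    (G := fun j i => act (k + 1) m (lowerAux p j i) v)
    (act_lowerAux_zero p · v) (fun j i => ?_) (fun j i c => ?_) hab ?_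
  · rw [act_lowerAux_succ hv, add_sub_add_right_eq_sub]
  · rw [opE_self_apply, (hasWeight_lowerAux p j i).dotUD_act hv, ← add_smul]
    congr 1
    simp only [Pi.sub_apply, Pi.single_apply, Fin.succ_inj, Fin.succ_ne_zero, if_false]
    ring
  · rw [opE_of_ne hne]; exact mem_subHighest.1 hv' a b hlt

theorem act_lowerOp_leading {ℓ : Fin (k + 1) → ℂ} {v : VPoly (k + 1) m}
    (hv : ∀ i, dotUD i i v = ℓ i • v) {p : Fin k}
    (hℓ : ∀ j < p, ℓ p.succ - ℓ j.succ + j - p ≠ 0) {N : Submodule ℂ (VPoly (k + 1) m)}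
    (hN : ∀ i j, ∀ P ∈ N, dotUD i j P ∈ N) (hvN : v ∈ N) :
    ∃ c : ℂ, c ≠ 0 ∧ act (k + 1) m (lowerOp p) v - c • dotUD p.succ 0 v ∈
      lowerPart dotUD N (p + 1) := by
  have key : ∀ j : ℕ, j ≤ p → ∃ c : ℂ, c ≠ 0 ∧
      act (k + 1) m (lowerAux p j p) v - c • dotUD p.succ 0 v ∈ lowerPart dotUD N (p + 1) := by
    intro j
    induction j with
    | zero =>
      intro _
      refine ⟨1, one_ne_zero, ?_⟩
      rw [act_lowerAux_zero, opE_of_ne (Fin.succ_ne_zero p), one_smul, sub_self]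
      exact zero_mem _
    | succ j ih =>
      intro hj
      obtain ⟨c, hc, hmem⟩ := ih (by omega)
      have hjp : (⟨j, by omega⟩ : Fin k) < p := hj
      have h1 := act_lowerAux_succ hv p p ⟨j, by omega⟩
      rw [opE_of_ne (by rw [Ne, Fin.succ_inj]; exact hjp.ne')] at h1
      refine ⟨_, mul_ne_zero (hℓ _ hjp) hc, ?_⟩
      simp only at h1
      rw [h1, mul_smul, add_sub_right_comm, ← smul_sub]
      exact add_mem (Submodule.smul_mem _ _ hmem)
        (mem_lowerPart hjp (Nat.lt_succ_self _) (act_apply_mem hN _ hvN))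
  exact key p le_rfl

/-- Under the betweenness conditions, the embedding factor maps a highest weight vector to a
highest weight vector of `gl(k)`, and agrees up to a nonzero factor with `lowerPow d` modulo the
image of the lowering operators of `gl(k)`. -/
theorem act_embeddingFactor {μ : Fin (k + 1) → ℕ} (hμ : Antitone μ) {d : Fin k → ℕ}
    (hd : Betweenness μ d) {h : VPoly (k + 1) m}
    (hh : IsHighestWeight dotUD (fun i => (μ i : ℂ)) h) {N : Submodule ℂ (VPoly (k + 1) m)}
    (hN : ∀ i j, ∀ P ∈ N, dotUD i j P ∈ N) (hhN : h ∈ N) (j : ℕ) (hj : j ≤ k) :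
    act (k + 1) m (embeddingFactor d j) h ∈ subHighest k m ∧
    ∃ c : ℂ, c ≠ 0 ∧ act (k + 1) m (embeddingFactor d j) h - c • lowerPow dotUD d j h ∈
      lowerPart dotUD N j := by
  induction j with
  | zero =>
    refine ⟨?_, 1, one_ne_zero, ?_⟩
    · rw [embeddingFactor, orderedProd, map_one]
      exact mem_subHighest.2 fun a b hab => hh.raise _ _ (Fin.succ_lt_succ_iff.2 hab)
    · rw [embeddingFactor, orderedProd, map_one, lowerPow, orderedProd, one_smul, sub_self]
      exact zero_mem _
  | succ j ih =>
    obtain ⟨hR, c₀, hc₀, hmem₀⟩ := ih (by omega)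
    set p : Fin k := ⟨j, hj⟩
    have key : ∀ t ≤ d p,
        act (k + 1) m (lowerOp p ^ t * embeddingFactor d j) h ∈ subHighest k m ∧
        ∃ c : ℂ, c ≠ 0 ∧ act (k + 1) m (lowerOp p ^ t * embeddingFactor d j) h -
          c • (dotUD p.succ 0 ^ t) (lowerPow dotUD d j h) ∈ lowerPart dotUD N (p + 1) := by
      intro t
      induction t with
      | zero =>
        intro _
        rw [pow_zero, one_mul, pow_zero]
        exact ⟨hR, c₀, hc₀, lowerPart_mono (Nat.le_succ _) hmem₀⟩
      | succ t iht =>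
        intro ht
        obtain ⟨h1, c, hc, h2⟩ := iht (by omega)
        have hw := (((hasWeight_lowerAux p p p).pow t).mul
          (hasWeight_embeddingFactor d j (by omega))).dotUD_act hh.weight
        change ∀ i, dotUD i i (act (k + 1) m (lowerOp p ^ t * embeddingFactor d j) h) = _ at hw
        have hℓ : ∀ q : Fin k, q < p →
            ((μ p.succ : ℂ) + ((t : ℂ) • (Pi.single p.succ 1 - Pi.single 0 1) +
              embeddingWeight d j : Fin (k + 1) → ℂ) p.succ) - ((μ q.succ : ℂ) +
              ((t : ℂ) • (Pi.single p.succ 1 - Pi.single 0 1) +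
              embeddingWeight d j : Fin (k + 1) → ℂ) q.succ) + q - p ≠ 0 := by
          intro q hq
          have hqj : (q : ℕ) < j := hq
          -- the gap between the shifted weights is `(μ_p + t) - (μ_q + d_q) + q - p < 0`
          have hle : μ p.castSucc ≤ μ q.succ := hμ (by
            rw [Fin.le_def, Fin.val_succ, Fin.val_castSucc]; exact hqj)
          have hdp := hd p
          have hp : ((p : ℕ) < j) = False := by simp [p]
          simp only [Pi.add_apply, Pi.smul_apply, Pi.sub_apply, embeddingWeight_apply_succ,
            Pi.single_apply, Fin.succ_inj, Fin.succ_ne_zero, if_false, if_true, hqj, hq.ne, hp,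
            smul_eq_mul]
          have : ((μ p.succ : ℤ) + t - (μ q.succ + d q) + q - p) ≠ 0 := by
            have : (p : ℕ) = j := rfl
            omega
          intro h0
          apply this
          have : (((μ p.succ : ℤ) + t - (μ q.succ + d q) + q - p : ℤ) : ℂ) = 0 := by
            push_cast
            rw [← h0]
            ring
          exact_mod_cast this
        have hmemN := act_apply_mem hN (lowerOp p ^ t * embeddingFactor d j) hhN
        obtain ⟨c', hc', h3⟩ := act_lowerOp_leading hw hℓ hN hmemN
        rw [pow_succ', mul_assoc, map_mul, Module.End.mul_apply]
        refine ⟨act_lowerOp_mem_subHighest hw h1 p, c' * c, mul_ne_zero hc' hc, ?_⟩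
        have h4 := Submodule.smul_mem _ c' (lower_zero_mem_lowerPart glRelations_dotUD hN p h2)
        have h5 := add_mem h3 h4
        rw [map_sub, map_smul, smul_sub, sub_add_sub_cancel, smul_smul,
          ← Module.End.mul_apply (dotUD p.succ 0), ← pow_succ'] at h5
        exact h5
    have h6 := key (d p) le_rfl
    rw [embeddingFactor, orderedProd, dif_pos (by omega), lowerPow_succ_apply, dif_pos (by omega)]
    exact h6

end lowering

/-! ### Type A solutions -/

section typeA

variable {k m : ℕ}

theorem fixFirst_X_succ (x : Fin m → ℝ) (i : Fin k) (a : Fin m) :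
    fixFirst x (X (i.succ, a)) = X (i, a) := by
  simp [fixFirst]

theorem fixFirst_pderiv (x : Fin m → ℝ) (i : Fin k) (a : Fin m) (P : VPoly (k + 1) m) :
    fixFirst x (pderiv (i.succ, a) P) = pderiv (i, a) (fixFirst x P) := by
  induction P using MvPolynomial.induction_on with
  | C c => rw [pderiv_C, map_zero, algHom_C, algebraMap_eq, pderiv_C]
  | add P Q hP hQ => simp only [map_add, hP, hQ]
  | mul_X P p hP =>
    rw [pderiv_mul, map_add, map_mul, map_mul, map_mul, pderiv_mul, hP]
    congr 2
    obtain ⟨j, b⟩ := p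
    refine Fin.cases ?_ (fun j => ?_) j
    · rw [pderiv_X_of_ne (by simp [(Fin.succ_ne_zero i).symm]), map_zero]
      simp [fixFirst]
    · rw [fixFirst_X_succ]
      by_cases h : (j, b) = (i, a)
      · obtain ⟨rfl, rfl⟩ := Prod.mk.inj h
        rw [pderiv_X_self, pderiv_X_self, map_one]
      · rw [pderiv_X_of_ne h, pderiv_X_of_ne, map_zero]
        simpa [Fin.succ_inj] using h

theorem fixFirst_dotUD (x : Fin m → ℝ) (i j : Fin k) (P : VPoly (k + 1) m) :
    fixFirst x (dotUD i.succ j.succ P) = dotUD i j (fixFirst x P) := by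
  simp only [dotUD_apply, map_sum, map_mul, fixFirst_X_succ, fixFirst_pderiv]

theorem fixFirst_dotDD (x : Fin m → ℝ) (i j : Fin k) (P : VPoly (k + 1) m) :
    fixFirst x (dotDD i.succ j.succ P) = dotDD i j (fixFirst x P) := by
  simp only [dotDD_apply, map_sum, fixFirst_pderiv]

/-- A polynomial that vanishes for all real values of the first vector variable is zero. -/
theorem eq_of_forall_fixFirst {P Q : VPoly (k + 1) m} (h : ∀ x, fixFirst x P = fixFirst x Q) :
    P = Q := by
  refine funext_set (fun p : Fin (k + 1) × Fin m =>
    if p.1 = 0 then Set.range ((↑) : ℝ → ℂ) else Set.univ) (fun p => ?_) fun y hy => ?_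
  · split_ifs
    · exact Set.infinite_range_of_injective Complex.ofReal_injective
    · exact Set.infinite_univ
  · have h0 : ∀ a, ∃ r : ℝ, (r : ℂ) = y (0, a) := fun a => by
      simpa using hy (0, a) (Set.mem_univ _)
    choose x hx using h0
    have key : ∀ R : VPoly (k + 1) m,
        eval y R = eval (fun p : Fin k × Fin m => y (p.1.succ, p.2)) (fixFirst x R) := by
      intro R
      induction R using MvPolynomial.induction_on with
      | C c => rw [algHom_C, algebraMap_eq, eval_C, eval_C]
      | add P Q hP hQ => simp only [map_add, hP, hQ]
      | mul_X P p hP =>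
        rw [map_mul, map_mul, map_mul, hP, eval_X]
        congr 1
        obtain ⟨j, b⟩ := p
        refine Fin.cases ?_ (fun j => ?_) j
        · simp [fixFirst, hx]
        · rw [fixFirst_X_succ, eval_X]
    rw [key, key, h]

theorem mem_weightedHomogeneous_zero_iff {l₀ : ℕ} {P : VPoly (k + 1) m} :
    P ∈ weightedHomogeneousSubmodule ℂ
      (fun p : Fin (k + 1) × Fin m => if p.1 = 0 then (1 : ℕ) else 0) l₀ ↔
      dotUD 0 0 P = (l₀ : ℂ) • P := by
  have hw : ∀ α : Fin (k + 1) × Fin m →₀ ℕ,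
      Finsupp.weight (fun p : Fin (k + 1) × Fin m => if p.1 = 0 then (1 : ℕ) else 0) α
        = ∑ a, α (0, a) := by
    intro α
    rw [Finsupp.weight_apply, Finsupp.sum_fintype _ _ (by simp), Fintype.sum_prod_type,
      Finset.sum_eq_single 0]
    · simp
    · intro b _ hb
      simp [hb]
    · simp
  rw [mem_weightedHomogeneousSubmodule, IsWeightedHomogeneous]
  constructor
  · intro h
    ext α
    rw [coeff_dotUD_self, coeff_smul, smul_eq_mul]
    by_cases hα : coeff α P = 0
    · rw [hα, mul_zero, mul_zero]
    · rw [← h hα, hw]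
  · intro h α hα
    have h1 := congrArg (coeff α) h
    rw [coeff_dotUD_self, coeff_smul, smul_eq_mul] at h1
    rw [hw]
    exact_mod_cast mul_right_cancel₀ hα h1

theorem dotDD_symm {n : ℕ} (i j : Fin n) (P : VPoly n m) : dotDD i j P = dotDD j i P := by
  simp only [dotDD_apply, pderiv_comm_apply (i, _)]

/-- Type A solutions are the homogeneous harmonic highest weight vectors of `gl(k)`. -/
theorem mem_typeA_iff {l₀ : ℕ} {l : Fin k → ℕ} {P : VPoly (k + 1) m} :
    P ∈ typeA k m l₀ l ↔ P ∈ multiHomogeneous (k + 1) m (Fin.cons l₀ l) ∧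
      P ∈ harmonics (k + 1) m ∧ P ∈ subHighest k m := by
  have hfix : (∀ x, fixFirst x P ∈ simplicialHarmonics k m l) ↔
      (∀ i j : Fin k, dotDD i.succ j.succ P = 0) ∧
      (∀ i : Fin k, dotUD i.succ i.succ P = (l i : ℂ) • P) ∧
      ∀ i j : Fin k, i < j → dotUD i.succ j.succ P = 0 := by
    simp only [mem_simplicialHarmonics_iff, mem_harmonics]
    constructor
    · intro h
      refine ⟨fun i j => ?_, fun i => ?_, fun i j hij => ?_⟩ <;>
        refine eq_of_forall_fixFirst fun x => ?_
      · rw [fixFirst_dotDD, (h x).1, map_zero]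
      · rw [fixFirst_dotUD, (h x).2.weight, map_smul]
      · rw [fixFirst_dotUD, (h x).2.raise i j hij, map_zero]
    · rintro ⟨h1, h2, h3⟩ x
      refine ⟨fun i j => ?_, fun i j hij => ?_, fun i => ?_⟩
      · rw [← fixFirst_dotDD, h1, map_zero]
      · rw [← fixFirst_dotUD, h3 i j hij, map_zero]
      · rw [← fixFirst_dotUD, h2, map_smul]
  have hA : P ∈ typeA k m l₀ l ↔ dotUD 0 0 P = (l₀ : ℂ) • P ∧
      (∀ x, fixFirst x P ∈ simplicialHarmonics k m l) ∧ dotDD 0 0 P = 0 ∧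
      ∀ i : Fin k, dotDD i.succ 0 P = 0 := by
    rw [← mem_weightedHomogeneous_zero_iff]
    simp [typeA, and_assoc]
  rw [hA, hfix, mem_multiHomogeneous_iff, mem_harmonics, mem_subHighest]
  constructor
  · rintro ⟨h0, ⟨h1, h2, h3⟩, h4, h5⟩
    refine ⟨fun i => Fin.cases h0 h2 i, fun i j => ?_, h3⟩
    refine Fin.cases (Fin.cases h4 (fun j => ?_) j) (fun i => Fin.cases (h5 i) (h1 i) j) i
    rw [dotDD_symm]; exact h5 j
  · rintro ⟨h1, h2, h3⟩
    exact ⟨h1 0, ⟨fun i j => h2 _ _, fun i => h1 i.succ, h3⟩, h2 0 0, fun i => h2 _ _⟩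

end typeA

/-! ### Branching of the module generated by `H_μ` -/

section branching

variable {k m : ℕ} {μ : Fin (k + 1) → ℕ}

theorem iSupIndep_multiHomogeneous (n m : ℕ) : iSupIndep (multiHomogeneous n m) := by
  classical
  let := weightedDecomposition ℂ (fun p : Fin n × Fin m => (Pi.single p.1 1 : Fin n → ℕ))
  exact (DirectSum.Decomposition.isInternal (weightedHomogeneousSubmodule ℂ
    (fun p : Fin n × Fin m => (Pi.single p.1 1 : Fin n → ℕ)))).submodule_iSupIndep

theorem generatedModule_le_loweringSpan :
    generatedModule (k + 1) m μ ≤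
      loweringSpan dotUD (simplicialHarmonics (k + 1) m μ) := by
  refine Submodule.span_le.2 ?_
  rintro _ ⟨a, h, hh, rfl⟩
  exact act_apply_mem (fun i j P hP => apply_mem_loweringSpan glRelations_dotUD
    (fun h hh => (mem_simplicialHarmonics_iff.1 hh).2) i j hP) a (mem_loweringSpan_of_mem hh)

theorem map_act_le_generatedModule (a : UGl (k + 1)) :
    (simplicialHarmonics (k + 1) m μ).map (act (k + 1) m a) ≤ generatedModule (k + 1) m μ := by
  rintro _ ⟨h, hh, rfl⟩
  exact Submodule.subset_span ⟨a, h, hh, rfl⟩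

theorem eq_zero_of_act_embeddingFactor_eq_zero (hμ : Antitone μ) {d : Fin k → ℕ}
    (hd : Betweenness μ d) {h : VPoly (k + 1) m} (hh : h ∈ simplicialHarmonics (k + 1) m μ)
    (h0 : act (k + 1) m (embeddingFactor d k) h = 0) : h = 0 := by
  by_contra hne
  have hw := (mem_simplicialHarmonics_iff.1 hh).2
  have hstable := fun i j P hP => apply_mem_loweringSpan (glRelations_dotUD (m := m))
    (H := Submodule.span ℂ {h}) (ν := fun i => (μ i : ℂ)) (w := P) (fun x hx => by
      obtain ⟨c, rfl⟩ := Submodule.mem_span_singleton.1 hx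
      exact (mem_simplicialHarmonics_iff.1 (Submodule.smul_mem _ c hh)).2) i j hP
  obtain ⟨-, c, hc, hmem⟩ := act_embeddingFactor hμ hd hw hstable
    (mem_loweringSpan_of_mem (Submodule.mem_span_singleton_self h)) k le_rfl
  rw [h0, zero_sub, Submodule.neg_mem_iff, Submodule.smul_mem_iff _ hc] at hmem
  exact lowerPow_notMem_lowerPart hμ hd hw hne hmem

theorem sum_le_of_betweenness (hμ : Antitone μ) {d : Fin k → ℕ} (hd : Betweenness μ d) :
    ∑ p, d p ≤ μ 0 := by
  have h1 := sum_sub_succ μ 0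
  simp only [Fin.zero_le, if_true] at h1
  have h2 : ∑ p : Fin k, (μ p.castSucc - μ p.succ) + μ (Fin.last k) = μ 0 := by
    have : ∀ p : Fin k, (((μ p.castSucc - μ p.succ : ℕ)) : ℂ) = μ p.castSucc - μ p.succ :=
      fun p => Nat.cast_sub (hμ Fin.castSucc_lt_succ.le)
    exact_mod_cast (by push_cast [this]; exact h1 :
      ((∑ p : Fin k, (μ p.castSucc - μ p.succ) + μ (Fin.last k) : ℕ) : ℂ) = (μ 0 : ℂ))
  have h3 : ∑ p, d p ≤ ∑ p : Fin k, (μ p.castSucc - μ p.succ) :=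
    Finset.sum_le_sum fun p _ => by have := hd p; omega
  omega

theorem map_embeddingFactor_le_typeA (hμ : Antitone μ) {d : Fin k → ℕ} (hd : Betweenness μ d)
    {l₀ : ℕ} (hl₀ : l₀ + ∑ p, d p = μ 0) :
    (simplicialHarmonics (k + 1) m μ).map (act (k + 1) m (embeddingFactor d k)) ≤
      typeA k m l₀ (fun p => μ p.succ + d p) := by
  rintro _ ⟨h, hh, rfl⟩
  obtain ⟨hh1, hh2⟩ := mem_simplicialHarmonics_iff.1 hh
  refine mem_typeA_iff.2 ⟨mem_multiHomogeneous_iff.2 fun i => ?_,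
    act_apply_mem (fun i j P hP => dotUD_mem_harmonics i j hP) _ hh1,
    (act_embeddingFactor hμ hd hh2 (N := ⊤) (fun _ _ _ _ => Submodule.mem_top)
      Submodule.mem_top k le_rfl).1⟩
  rw [(hasWeight_embeddingFactor d k le_rfl).dotUD_act hh2.weight]
  congr 1
  refine Fin.cases ?_ (fun p => ?_) i
  · rw [embeddingWeight_apply_zero, Fin.cons_zero, ← hl₀]
    push_cast
    ring
  · rw [embeddingWeight_apply_succ, if_pos p.2, Fin.cons_succ, Nat.cast_add]

/-- Every highest weight vector of `gl(k)` in the module generated by `H_μ` is a sum of images of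
embedding factors: it differs from such a sum by an element of the image of the lowering operators
of `gl(k)`, to which highest weight vectors are orthogonal. -/
theorem generatedModule_inf_subHighest_le (hμ : Antitone μ) :
    generatedModule (k + 1) m μ ⊓ subHighest k m ≤
      ⨆ d : {d : Fin k → ℕ // Betweenness μ d},
        (simplicialHarmonics (k + 1) m μ).map (act (k + 1) m (embeddingFactor d.1 k)) := by
  rintro v ⟨hv, hv'⟩
  set H := simplicialHarmonics (k + 1) m μ
  set N := loweringSpan dotUD H
  set S := ⨆ d : {d : Fin k → ℕ // Betweenness μ d},
    H.map (act (k + 1) m (embeddingFactor d.1 k))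
  have hH : ∀ h ∈ H, IsHighestWeight dotUD (fun i => (μ i : ℂ)) h :=
    fun h hh => (mem_simplicialHarmonics_iff.1 hh).2
  have hN : ∀ i j, ∀ P ∈ N, dotUD i j P ∈ N := fun i j P hP =>
    apply_mem_loweringSpan glRelations_dotUD hH i j hP
  have hle : N ≤ lowerPart dotUD N k ⊔ S := by
    refine (loweringSpan_le_sup_lowerPow glRelations_dotUD).trans
      (sup_le le_sup_left (iSup_le fun d => ?_))
    rintro _ ⟨h, hh, rfl⟩
    have hhN : h ∈ N := mem_loweringSpan_of_mem hh
    by_cases hd : Betweenness μ d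
    · obtain ⟨-, c, hc, hmem⟩ := act_embeddingFactor hμ hd (hH h hh) hN hhN k le_rfl
      rw [← Submodule.smul_mem_iff _ hc]
      have h1 : act (k + 1) m (embeddingFactor d k) h ∈ S :=
        Submodule.mem_iSup_of_mem ⟨d, hd⟩ ⟨h, hh, rfl⟩
      have h2 := sub_mem (Submodule.mem_sup_right h1) (Submodule.mem_sup_left (T := S) hmem)
      rwa [sub_sub_cancel] at h2
    · exact Submodule.mem_sup_left (lowerPow_mem_lowerPart hμ hd hN hhN (hH h hh))
  have hS : S ≤ subHighest k m := iSup_le fun d => by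
    rintro _ ⟨h, hh, rfl⟩
    exact (act_embeddingFactor hμ d.2 (hH h hh) hN (mem_loweringSpan_of_mem hh) k le_rfl).1
  obtain ⟨n, hn, s, hs, rfl⟩ := Submodule.mem_sup.1 (hle (generatedModule_le_loweringSpan hv))
  have hn' : n ∈ subHighest k m := by simpa using sub_mem hv' (hS hs)
  rw [eq_zero_of_mem_subHighest_of_mem_lowerPart hn' hn, zero_add]
  exact hs

/-- The degrees of the polynomials in the image of the embedding factor on `H_μ`. -/
def imageDegree (μ : Fin (k + 1) → ℕ) (d : Fin k → ℕ) : Fin (k + 1) → ℕ :=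
  Fin.cons (μ 0 - ∑ p, d p) (fun p => μ p.succ + d p)

theorem imageDegree_injective (μ : Fin (k + 1) → ℕ) :
    Function.Injective (imageDegree (k := k) μ) := by
  intro d d' h
  funext p
  have := congrFun h p.succ
  simpa [imageDegree] using this

theorem map_embeddingFactor_le_multiHomogeneous (hμ : Antitone μ) {d : Fin k → ℕ}
    (hd : Betweenness μ d) :
    (simplicialHarmonics (k + 1) m μ).map (act (k + 1) m (embeddingFactor d k)) ≤
      multiHomogeneous (k + 1) m (imageDegree μ d) := fun _ hP =>
  (mem_typeA_iff.1 (map_embeddingFactor_le_typeA hμ hd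
    (Nat.sub_add_cancel (sum_le_of_betweenness hμ hd)) hP)).1

theorem mem_of_mem_iSup_of_iSupIndep {ι κ V : Type*} [AddCommGroup V] [Module ℂ V]
    {A : κ → Submodule ℂ V} (hA : iSupIndep A) {B : ι → Submodule ℂ V} {f : ι → κ}
    (hB : ∀ i, B i ≤ A (f i)) {v : V} (hv : v ∈ ⨆ i, B i) {a : κ} (ha : v ∈ A a) :
    v ∈ ⨆ (i : ι) (_ : f i = a), B i := by
  have hle : ⨆ i, B i ≤ (⨆ (i : ι) (_ : f i = a), B i) ⊔ ⨆ (b : κ) (_ : b ≠ a), A b := by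
    refine iSup_le fun i => ?_
    by_cases h : f i = a
    · exact le_sup_of_le_left (le_iSup₂_of_le i h le_rfl)
    · exact le_sup_of_le_right (le_iSup₂_of_le (f i) h (hB i))
  obtain ⟨x, hx, y, hy, rfl⟩ := Submodule.mem_sup.1 (hle hv)
  have hxa : x ∈ A a := by
    have : ⨆ (i : ι) (_ : f i = a), B i ≤ A a := iSup₂_le fun i h => h ▸ hB i
    exact this hx
  have hya : y ∈ A a := by simpa using sub_mem ha hxa
  rw [Submodule.disjoint_def.1 (hA a) y hya hy, add_zero]
  exact hx

theorem generatedModule_inf_typeA_le (hμ : Antitone μ) (l₀ : ℕ) (l : Fin k → ℕ) :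
    generatedModule (k + 1) m μ ⊓ typeA k m l₀ l ≤
      ⨆ (d : {d : Fin k → ℕ // Betweenness μ d}) (_ : imageDegree μ d.1 = Fin.cons l₀ l),
        (simplicialHarmonics (k + 1) m μ).map (act (k + 1) m (embeddingFactor d.1 k)) := by
  rintro v ⟨hv, hv'⟩
  obtain ⟨h1, -, h2⟩ := mem_typeA_iff.1 hv'
  exact mem_of_mem_iSup_of_iSupIndep (iSupIndep_multiHomogeneous (k + 1) m)
    (f := fun d : {d : Fin k → ℕ // Betweenness μ d} => imageDegree μ d.1)
    (fun d => map_embeddingFactor_le_multiHomogeneous hμ d.2)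
    (generatedModule_inf_subHighest_le hμ ⟨hv, h2⟩) h1

end branching

end HigherSpin

theorem mainTheorem3 (k m : ℕ) :
    ∃ ρ : (Fin k → ℕ) → HigherSpin.UGl (k + 1),
      (∀ d : Fin k → ℕ, HigherSpin.IsHomogeneousFactor d (ρ d)) ∧
      ∀ μ : Fin (k + 1) → ℕ, Antitone μ →
        -- each `ρ d` that satisfies betweenness embeds `H_μ`, compatibly with the action of `O(m)`
        (∀ d : Fin k → ℕ, HigherSpin.Betweenness μ d →
          Set.InjOn (HigherSpin.act (k + 1) m (ρ d))
              (HigherSpin.simplicialHarmonics (k + 1) m μ : Set (HigherSpin.VPoly (k + 1) m)) ∧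
          ∀ g ∈ Matrix.orthogonalGroup (Fin m) ℝ, ∀ P : HigherSpin.VPoly (k + 1) m,
            HigherSpin.act (k + 1) m (ρ d) (HigherSpin.rotate (k + 1) g P) =
              HigherSpin.rotate (k + 1) g (HigherSpin.act (k + 1) m (ρ d) P)) ∧
        -- the contribution of `V(μ)*` to the type A solutions of the matching degrees
        (∀ d : Fin k → ℕ, HigherSpin.Betweenness μ d → ∀ l₀ : ℕ, l₀ + ∑ p, d p = μ 0 →
          HigherSpin.generatedModule (k + 1) m μ ⊓
              HigherSpin.typeA k m l₀ (fun p => μ p.succ + d p) =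
            (HigherSpin.simplicialHarmonics (k + 1) m μ).map (HigherSpin.act (k + 1) m (ρ d))) ∧
        -- there is no contribution in other degrees
        (∀ (l₀ : ℕ) (l : Fin k → ℕ),
          HigherSpin.generatedModule (k + 1) m μ ⊓ HigherSpin.typeA k m l₀ l ≠ ⊥ →
            ∃ d : Fin k → ℕ, HigherSpin.Betweenness μ d ∧ l₀ + ∑ p, d p = μ 0 ∧
              ∀ p, l p = μ p.succ + d p) ∧
        -- the whole contribution is the direct sum of these pieces
        HigherSpin.generatedModule (k + 1) m μ ⊓ HigherSpin.typeATotal k m =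
            (⨆ d : {d : Fin k → ℕ // HigherSpin.Betweenness μ d},
              (HigherSpin.simplicialHarmonics (k + 1) m μ).map
                (HigherSpin.act (k + 1) m (ρ d.1))) ∧
        iSupIndep (fun d : {d : Fin k → ℕ // HigherSpin.Betweenness μ d} =>
          (HigherSpin.simplicialHarmonics (k + 1) m μ).map
            (HigherSpin.act (k + 1) m (ρ d.1))) := by
  refine ⟨fun d => HigherSpin.embeddingFactor d k,
    HigherSpin.isHomogeneousFactor_embeddingFactor,
    fun μ hμ => ⟨fun d hd => ⟨?_, ?_⟩, ?_, ?_, ?_, ?_⟩⟩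
  · intro h hh h' hh' heq
    refine sub_eq_zero.1 (HigherSpin.eq_zero_of_act_embeddingFactor_eq_zero hμ hd
      (sub_mem hh hh') ?_)
    rw [map_sub]
    exact sub_eq_zero.2 heq
  · exact fun g _ P => HigherSpin.act_rotate g _ P
  · intro d hd l₀ hl₀
    refine le_antisymm ((HigherSpin.generatedModule_inf_typeA_le hμ _ _).trans
      (iSup₂_le fun d' hd' => ?_)) (le_inf (HigherSpin.map_act_le_generatedModule _)
        (HigherSpin.map_embeddingFactor_le_typeA hμ hd hl₀))
    have h : HigherSpin.imageDegree μ d'.1 = HigherSpin.imageDegree μ d := by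
      rw [hd', HigherSpin.imageDegree, ← hl₀, Nat.add_sub_cancel]
    rw [HigherSpin.imageDegree_injective μ h]
  · intro l₀ l hne
    by_contra hcon
    refine hne (le_bot_iff.1 ((HigherSpin.generatedModule_inf_typeA_le hμ _ _).trans
      (iSup₂_le fun d hd => ?_)))
    refine absurd ⟨d.1, d.2, ?_, fun p => ?_⟩ hcon
    · have h := congrFun hd 0
      rw [HigherSpin.imageDegree, Fin.cons_zero, Fin.cons_zero] at h
      rw [← h, Nat.sub_add_cancel (HigherSpin.sum_le_of_betweenness hμ d.2)]
    · have h := congrFun hd p.succ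
      rw [HigherSpin.imageDegree, Fin.cons_succ, Fin.cons_succ] at h
      exact h.symm
  · refine le_antisymm (le_trans (inf_le_inf_left _ ?_)
      (HigherSpin.generatedModule_inf_subHighest_le hμ)) (iSup_le fun d => le_inf
        (HigherSpin.map_act_le_generatedModule _) ?_)
    · exact iSup₂_le fun l₀ l P hP => (HigherSpin.mem_typeA_iff.1 hP).2.2
    · exact le_trans (HigherSpin.map_embeddingFactor_le_typeA hμ d.2
        (Nat.sub_add_cancel (HigherSpin.sum_le_of_betweenness hμ d.2)))
        (le_iSup₂ (f := fun l₀ l => HigherSpin.typeA k m l₀ l) _ _)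
  · exact ((HigherSpin.iSupIndep_multiHomogeneous (k + 1) m).comp
      ((HigherSpin.imageDegree_injective μ).comp Subtype.val_injective)).mono fun d =>
        HigherSpin.map_embeddingFactor_le_multiHomogeneous hμ d.2
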